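/- Let $X,Y$ be finite nonempty sets, $Z$ a set and $f:X\times Y\to Z$. **Forbidden submatrices.** The communication matrix of $f$ has rows indexed by $X$, columns indexed by $Y$ and entry $f(x,y)$ at $(x,y)$. For a matrix $M$, write $x\equiv' x'$ for two rows if $M_{x,y}=M_{x',y}$ for some column $y$, and let $\equiv$ be the transitive closure of $\equiv'$; define the analogous relations for columns. $M$ is *forbidden* if all its rows are equivalent, all its columns are equivalent, and its entries are not all the same. A submatrix is given by a set $A\subseteq X$ of rows and a set $B\subseteq Y$ of columns, and the equivalences are taken inside the submatrix. **Quantum protocols.** Al holds a classical input $x\in X$, Bob holds $y\in Y$, and finitely many qubits, each owned by one of the players, start in the state $|0\cdots0\rangle$. There are finitely many rounds. In each round one player applies to the qubits he owns a unitary transformation depending on his input and the round, and then passes some of his qubits to the other player. The inputs are never erased, and there is no public coin. At the end a player measures his qubits in the computational basis and determines a result from the outcome and his input. The protocol computes $f$ with error $\varepsilon$ for a player if, for all $(x,y)$, the result of this player is $f(x,y)$ with probability at least $1-\varepsilon$. **Classical protocols.** Each player draws the value of private coins from a finite probability space. In each round one player sends a bit string determined by his input, his coins and the previous messages; at the end each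 player determines a result from his input, his coins and all messages. The protocol is deterministic if the coins of both players take only one value. **Privacy loss.** For a distribution $\mu$ of the inputs $(X,Y)$ and a time $t$ (after any number of rounds), let $A$ and $B$ be what Al and Bob hold at time $t$ besides the inputs (the qubits they own; in the classical case their coins and the messages so far). The information divulged to Bob is $I(B:X\mid Y,f(X,Y))$, and the information divulged to Al is $I(A:Y\mid X,f(X,Y))$, where $I(P:Q\mid C)=S(PC)+S(QC)-S(C)-S(PQC)$ with the von Neumann entropy $S$ (the Shannon entropy in the classical case). The privacy loss of a protocol is the supremum of these quantities over all $t$, both players and all $\mu$. **Theorem.** (a) If the communication matrix of $f$ contains a forbidden submatrix, then no quantum protocol with privacy loss $0$ computes $f$ with an error $\varepsilon<1/2$, not even for only one of the players. (b) The following are equivalent, where "computes $f$" means that it does so for both players: 1. the communication matrix of $f$ contains no forbidden submatrix; 2. some deterministic protocol with privacy loss $0$ computes $f$ without error; 3. some classical randomized protocol with privacy loss $0$ computes $f$ without error; 4. for some $\varepsilon<1/2$, some classical randomized protocol with privacy loss $0$ computes $f$ with error $\varepsilon$; 5. some quantum protocol with privacy loss $0$ computes $f$ without error; 6. for some $\varepsilon<1/2$,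 some quantum protocol with privacy loss $0$ computes $f$ with error $\varepsilon$. -/

import Mathlib

open scoped BigOperators

noncomputable section

/-! # Communication matrices and forbidden submatrices -/

/-- `x ≡' x'`: the rows `x` and `x'` of `M` agree in some column. -/
def RowRel {R C Z : Type*} (M : Matrix R C Z) (x x' : R) : Prop :=
  ∃ y, M x y = M x' y

/-- `y ≡' y'`: the columns `y` and `y'` of `M` agree in some row. -/
def ColRel {R C Z : Type*} (M : Matrix R C Z) (y y' : C) : Prop :=
  ∃ x, M x y = M x y'

/-- All entries of `M` are the same. -/
def IsMonochromatic {R C Z : Type*} (M : Matrix R C Z) : Prop :=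
  ∀ x x' y y', M x y = M x' y'

/-- All rows are equivalent and all columns are equivalent (for the transitive closures of the
relations above), and the matrix is not monochromatic. -/
def IsForbidden {R C Z : Type*} (M : Matrix R C Z) : Prop :=
  (∀ x x', Relation.TransGen (RowRel M) x x') ∧
  (∀ y y', Relation.TransGen (ColRel M) y y') ∧
  ¬ IsMonochromatic M

/-- The communication matrix of `f` has a forbidden submatrix, with rows `A` and columns `B`. -/
def ContainsForbidden {X Y Z : Type*} (f : X → Y → Z) : Prop :=
  ∃ (A : Set X) (B : Set Y),
    IsForbidden ((Matrix.of f).submatrix (fun a : A => (a : X)) (fun b : B => (b : Y)))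

/-- The two players. -/
inductive Player where
  | al : Player
  | bob : Player
  deriving DecidableEq

/-! # Quantum information -/

/-- The von Neumann entropy `-∑ λ log₂ λ`, over the multiset of all eigenvalues of `ρ`. -/
def vonNeumannEntropy {ι : Type*} [Fintype ι] [DecidableEq ι] (ρ : Matrix ι ι ℂ) : ℝ :=
  (ρ.charpoly.roots.map (fun z : ℂ => -(z.re * Real.logb 2 z.re))).sum

/-- `I(P : Q | C) = S(PC) + S(QC) - S(C) - S(PQC)` for a state `ρ` on `P ⊗ Q ⊗ C`, with the
reduced states given by partial traces. -/
def quantumCondMutualInfo {P Q C : Type*} [Fintype P] [Fintype Q] [Fintype C]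
    [DecidableEq P] [DecidableEq Q] [DecidableEq C]
    (ρ : Matrix (P × Q × C) (P × Q × C) ℂ) : ℝ :=
  vonNeumannEntropy
      (Matrix.of fun (i j : P × C) => ∑ q : Q, ρ (i.1, q, i.2) (j.1, q, j.2))
    + vonNeumannEntropy
      (Matrix.of fun (i j : Q × C) => ∑ p : P, ρ (p, i.1, i.2) (p, j.1, j.2))
    - vonNeumannEntropy
      (Matrix.of fun (i j : C) => ∑ p : P, ∑ q : Q, ρ (p, q, i) (p, q, j))
    - vonNeumannEntropy ρ

open Classical in
/-- The information `I(R : O | K, g(O, K))`, where `O` (the other player's input) and `K` (the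
player's own input) are distributed according to `μ`, and the player's quantum register `R` is in
the state `σ o k` on inputs `o, k`. It is taken in the joint state
`∑ μ(o, k) σ(o, k) ⊗ |o⟩⟨o| ⊗ |k⟩⟨k| ⊗ |g(o, k)⟩⟨g(o, k)|`. -/
def quantumDivulged {R O K Z : Type*} [Fintype R] [Fintype O] [Fintype K]
    (g : O → K → Z) (σ : O → K → Matrix R R ℂ) (μ : O → K → ℝ) : ℝ :=
  quantumCondMutualInfo
    (Matrix.of fun (i j : R × O × (K × Set.range (fun a : O × K => g a.1 a.2))) =>
      if i.2 = j.2 ∧ (i.2.2.2 : Z) = g i.2.1 i.2.2.1 then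
        (μ i.2.1 i.2.2.1 : ℂ) * σ i.2.1 i.2.2.1 i.1 j.1
      else 0)

/-! # Quantum protocols -/

/-- The computational basis states of the qubits `q` with `S q`. -/
abbrev Bits {n : ℕ} (S : Fin n → Prop) : Type := {q : Fin n // S q} → Bool

/-- The joint basis state of all qubits: `a` on the qubits in `S` and `c` on the others. -/
def merge {n : ℕ} (S : Fin n → Prop) [DecidablePred S] (a : Bits S) (c : Bits fun q => ¬ S q) :
    Fin n → Bool :=
  (Equiv.piEquivPiSubtypeProd S fun _ => Bool).symm (a, c)

/-- Apply `U ⊗ 1` to the state vector `ψ`, where `U` acts on the qubits in `S`. -/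
def applyLocal {n : ℕ} (S : Fin n → Prop) [DecidablePred S] (U : Matrix (Bits S) (Bits S) ℂ)
    (ψ : (Fin n → Bool) → ℂ) : (Fin n → Bool) → ℂ :=
  fun c => ∑ a : Bits S, U (fun q => c q) a * ψ (merge S a fun q => c q)

/-- The reduced density matrix of the pure state `ψ` on the qubits in `S`. -/
def reducedState {n : ℕ} (S : Fin n → Prop) [DecidablePred S] (ψ : (Fin n → Bool) → ℂ) :
    Matrix (Bits S) (Bits S) ℂ :=
  Matrix.of fun a b => ∑ c : Bits (fun q => ¬ S q), ψ (merge S a c) * star (ψ (merge S b c))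

/-- A two-party quantum protocol. All qubits start in the state `|0⟩`, and each of them is owned by
one of the players. In round `t` the player `speaker t` applies to the qubits he owns a unitary
transformation that is controlled by his (classical, never erased) input, and then gives some of his
qubits to the other player. After the last round a player may measure his qubits in the
computational basis and read off a result. There is neither a public coin nor prior entanglement.
What the fields say about rounds after the last one is not used. -/
structure QuantumProtocol (X Y Z : Type*) where
  /-- the total number of private and message qubits -/
  qubits : ℕ
  /-- the number of rounds -/
  rounds : ℕ
  /-- the player whose turn it is in round `t` -/
  speaker : ℕ → Player
  /-- the owner of a qubit when `t` rounds have been played -/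
  owner : ℕ → Fin qubits → Player
  /-- only the player whose turn it is can give qubits away -/
  owner_succ : ∀ t q, owner t q ≠ speaker t → owner (t + 1) q = owner t q
  /-- what Al does in round `t`, if it is his turn -/
  opAl : (t : ℕ) → X → Matrix.unitaryGroup (Bits fun q => owner t q = Player.al) ℂ
  /-- what Bob does in round `t`, if it is his turn -/
  opBob : (t : ℕ) → Y → Matrix.unitaryGroup (Bits fun q => owner t q = Player.bob) ℂ
  /-- the result that Al reads off -/
  outAl : X → (Bits fun q => owner rounds q = Player.al) → Z
  /-- the result that Bob reads off -/
  outBob : Y → (Bits fun q => owner rounds q = Player.bob) → Z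

namespace QuantumProtocol

variable {X Y Z : Type*}

/-- The joint state of all qubits on inputs `x, y` when `t` rounds have been played. -/
def state (P : QuantumProtocol X Y Z) (x : X) (y : Y) : ℕ → (Fin P.qubits → Bool) → ℂ
  | 0 => Pi.single (fun _ => false) 1
  | t + 1 =>
    match P.speaker t with
    | Player.al => applyLocal (fun q => P.owner t q = Player.al) (P.opAl t x).1 (state P x y t)
    | Player.bob => applyLocal (fun q => P.owner t q = Player.bob) (P.opBob t y).1 (state P x y t)

/-- The result of player `p` on inputs `x, y`, if the final measurement finds all qubits in the
basis state `c`. -/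
def result (P : QuantumProtocol X Y Z) (p : Player) (x : X) (y : Y) (c : Fin P.qubits → Bool) : Z :=
  match p with
  | Player.al => P.outAl x fun q => c q
  | Player.bob => P.outBob y fun q => c q

open Classical in
/-- The probability that player `p` ends with the result `z` on inputs `x, y`. -/
def resultProb (P : QuantumProtocol X Y Z) (p : Player) (x : X) (y : Y) (z : Z) : ℝ :=
  ∑ c : Fin P.qubits → Bool, if P.result p x y c = z then ‖P.state x y P.rounds c‖ ^ 2 else 0

/-- On all inputs, player `p` ends with the result `f x y` with probability at least `1 - ε`. -/
def Computes (P : QuantumProtocol X Y Z) (p : Player) (f : X → Y → Z) (ε : ℝ) : Prop :=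
  ∀ x y, 1 - ε ≤ P.resultProb p x y (f x y)

variable [Fintype X] [Fintype Y]

/-- The information `L(t, p, μ)` divulged to player `p` when `t` rounds have been played:
`I(A : Y | X, f(X, Y))` for Al and `I(B : X | Y, f(X, Y))` for Bob, where `A` and `B` are the
qubits that the player then owns and the inputs are distributed according to `μ`. -/
def divulged (P : QuantumProtocol X Y Z) (f : X → Y → Z) (t : ℕ) (p : Player)
    (μ : X × Y → ℝ) : ℝ :=
  match p with
  | Player.al =>
    quantumDivulged (fun y x => f x y)
      (fun y x => reducedState (fun q => P.owner t q = Player.al) (P.state x y t))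
      (fun y x => μ (x, y))
  | Player.bob =>
    quantumDivulged f
      (fun x y => reducedState (fun q => P.owner t q = Player.bob) (P.state x y t))
      (fun x y => μ (x, y))

/-- The privacy loss: the supremum of `L(t, p, μ)` over all times, players and distributions on the
inputs. -/
def privacyLoss (P : QuantumProtocol X Y Z) (f : X → Y → Z) : EReal :=
  ⨆ (t : Fin (P.rounds + 1)) (p : Player) (μ : stdSimplex ℝ (X × Y)),
    ((P.divulged f t p μ.1 : ℝ) : EReal)

end QuantumProtocol

/-! # Classical protocols -/

open Classical in
/-- The Shannon entropy (in bits) of the random variable `W` on a finite sample space `Ω` with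
probability function `pr`. -/
def shannonEntropy {Ω α : Type*} [Fintype Ω] (pr : Ω → ℝ) (W : Ω → α) : ℝ :=
  ∑ w ∈ Finset.univ.image W,
    -((∑ ω, if W ω = w then pr ω else 0) * Real.logb 2 (∑ ω, if W ω = w then pr ω else 0))

/-- `I(U : V | W) = H(U, W) + H(V, W) - H(W) - H(U, V, W)` for random variables. -/
def condMutualInfo {Ω α β γ : Type*} [Fintype Ω] (pr : Ω → ℝ) (U : Ω → α) (V : Ω → β)
    (W : Ω → γ) : ℝ :=
  shannonEntropy pr (fun ω => (U ω, W ω)) + shannonEntropy pr (fun ω => (V ω, W ω))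
    - shannonEntropy pr W - shannonEntropy pr (fun ω => (U ω, V ω, W ω))

/-- A two-party classical randomized protocol with private coins. At the start each player draws
the value of his coins from a finite set. In round `t` the player `speaker t` sends a bit string
that is determined by his input, his coins and the messages of the previous rounds. In the end each
player determines a result from his input, his coins and all messages. -/
structure ClassicalProtocol (X Y Z : Type*) where
  /-- the number of values of Al's coins -/
  coinsAl : ℕ
  /-- the number of values of Bob's coins -/
  coinsBob : ℕ
  /-- the distribution of Al's coins -/
  distAl : stdSimplex ℝ (Fin coinsAl)
  /-- the distribution of Bob's coins -/
  distBob : stdSimplex ℝ (Fin coinsBob)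
  /-- the number of rounds -/
  rounds : ℕ
  /-- the player whose turn it is in round `t` -/
  speaker : ℕ → Player
  /-- Al's message in round `t`, if it is his turn -/
  msgAl : ℕ → X → Fin coinsAl → List (List Bool) → List Bool
  /-- Bob's message in round `t`, if it is his turn -/
  msgBob : ℕ → Y → Fin coinsBob → List (List Bool) → List Bool
  /-- Al's result -/
  outAl : X → Fin coinsAl → List (List Bool) → Z
  /-- Bob's result -/
  outBob : Y → Fin coinsBob → List (List Bool) → Z

namespace ClassicalProtocol

variable {X Y Z : Type*}

/-- The players use no randomness: their coins have only one value. -/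
def IsDeterministic (P : ClassicalProtocol X Y Z) : Prop :=
  P.coinsAl = 1 ∧ P.coinsBob = 1

/-- The messages of the first `t` rounds on inputs `x, y` and coin values `r, s`. -/
def transcript (P : ClassicalProtocol X Y Z) (x : X) (y : Y) (r : Fin P.coinsAl)
    (s : Fin P.coinsBob) : ℕ → List (List Bool)
  | 0 => []
  | t + 1 =>
    transcript P x y r s t ++
      [match P.speaker t with
        | Player.al => P.msgAl t x r (transcript P x y r s t)
        | Player.bob => P.msgBob t y s (transcript P x y r s t)]

/-- The result of player `p` on inputs `x, y` and coin values `r, s`. -/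
def result (P : ClassicalProtocol X Y Z) (p : Player) (x : X) (y : Y) (r : Fin P.coinsAl)
    (s : Fin P.coinsBob) : Z :=
  match p with
  | Player.al => P.outAl x r (P.transcript x y r s P.rounds)
  | Player.bob => P.outBob y s (P.transcript x y r s P.rounds)

open Classical in
/-- The probability that player `p` ends with the result `z` on inputs `x, y`. -/
def resultProb (P : ClassicalProtocol X Y Z) (p : Player) (x : X) (y : Y) (z : Z) : ℝ :=
  ∑ r : Fin P.coinsAl, ∑ s : Fin P.coinsBob,
    if P.result p x y r s = z then P.distAl.1 r * P.distBob.1 s else 0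

/-- On all inputs, player `p` ends with the result `f x y` with probability at least `1 - ε`. -/
def Computes (P : ClassicalProtocol X Y Z) (p : Player) (f : X → Y → Z) (ε : ℝ) : Prop :=
  ∀ x y, 1 - ε ≤ P.resultProb p x y (f x y)

variable [Fintype X] [Fintype Y]

/-- The information `L(t, p, μ)` divulged to player `p` when `t` rounds have been played:
`I(A : Y | X, f(X, Y))` for Al and `I(B : X | Y, f(X, Y))` for Bob, where `A` and `B` consist of the
player's coins and the messages so far, and the inputs are distributed according to `μ`. -/
def divulged (P : ClassicalProtocol X Y Z) (f : X → Y → Z) (t : ℕ) (p : Player)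
    (μ : X × Y → ℝ) : ℝ :=
  let pr : (X × Y) × Fin P.coinsAl × Fin P.coinsBob → ℝ :=
    fun ω => μ ω.1 * (P.distAl.1 ω.2.1 * P.distBob.1 ω.2.2)
  match p with
  | Player.al =>
    condMutualInfo pr (fun ω => (ω.2.1, P.transcript ω.1.1 ω.1.2 ω.2.1 ω.2.2 t))
      (fun ω => ω.1.2) (fun ω => (ω.1.1, f ω.1.1 ω.1.2))
  | Player.bob =>
    condMutualInfo pr (fun ω => (ω.2.2, P.transcript ω.1.1 ω.1.2 ω.2.1 ω.2.2 t))
      (fun ω => ω.1.1) (fun ω => (ω.1.2, f ω.1.1 ω.1.2))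

/-- The privacy loss: the supremum of `L(t, p, μ)` over all times, players and distributions on the
inputs. -/
def privacyLoss (P : ClassicalProtocol X Y Z) (f : X → Y → Z) : EReal :=
  ⨆ (t : Fin (P.rounds + 1)) (p : Player) (μ : stdSimplex ℝ (X × Y)),
    ((P.divulged f t p μ.1 : ℝ) : EReal)

end ClassicalProtocol

/-! # Private functions -/

/-- Some quantum protocol with privacy loss `0` computes `f` with error `ε`, and both players learn
the result. -/
def QuantumPrivate {X Y Z : Type*} [Fintype X] [Fintype Y] (f : X → Y → Z) (ε : ℝ) : Prop :=
  ∃ P : QuantumProtocol X Y Z, (∀ p, P.Computes p f ε) ∧ P.privacyLoss f = 0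

/-- Some classical randomized protocol with privacy loss `0` computes `f` with error `ε`, and both
players learn the result. -/
def ClassicalPrivate {X Y Z : Type*} [Fintype X] [Fintype Y] (f : X → Y → Z) (ε : ℝ) : Prop :=
  ∃ P : ClassicalProtocol X Y Z, (∀ p, P.Computes p f ε) ∧ P.privacyLoss f = 0

/-- Some deterministic protocol with privacy loss `0` computes `f` without error, and both players
learn the result. -/
def DeterministicPrivate {X Y Z : Type*} [Fintype X] [Fintype Y] (f : X → Y → Z) : Prop :=
  ∃ P : ClassicalProtocol X Y Z, P.IsDeterministic ∧ (∀ p, P.Computes p f 0) ∧ P.privacyLoss f = 0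

end

/-!
Strict concavity of the von Neumann entropy turns privacy loss `0` into a statement about states:
at any time, what a player holds besides the inputs depends only on his own input and the value of
`f`.

Inside a forbidden submatrix this rules out any progress. Suppose that the joint states arise from
a single one by local unitary transformations that depend on the input of the player who applies
them. Then the reduced state of either player depends on his input only through such a
transformation and, since equal entries of `f` link all rows and all columns, it does not depend on
the input of the other player at all. A message therefore cannot spoil the relation, because
purifications are unique up to a unitary transformation of the purifying system. In the classical
case the coins that are compatible with a transcript form a rectangle, so that the probability of
the transcript is a product, and the same links make it independent of the inputs. Either way the
result cannot depend on the inputs although `f` does.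

Conversely, without a forbidden submatrix the players in turn announce the equivalence class of
their input in the submatrix of those inputs that are still possible. Equal entries of `f` lie in
the same classes, so that nothing beyond the value of `f` is revealed, and when the submatrix no
longer shrinks it is constant. A quantum protocol can announce a class by a change of the basis
state of the qubits.
-/

/-! # Entropies -/

section Entropy

/-- The summand `-x log₂ x` of the Shannon and von Neumann entropies. -/
noncomputable def negMulLogTwo (x : ℝ) : ℝ := -(x * Real.logb 2 x)

lemma negMulLogTwo_eq (x : ℝ) : negMulLogTwo x = (Real.log 2)⁻¹ * Real.negMulLog x := by
  unfold negMulLogTwo Real.negMulLog Real.logb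
  ring

@[simp] lemma negMulLogTwo_zero : negMulLogTwo 0 = 0 := by simp [negMulLogTwo]

lemma negMulLogTwo_mul (x y : ℝ) :
    negMulLogTwo (x * y) = x * negMulLogTwo y + negMulLogTwo x * y := by
  simp only [negMulLogTwo_eq, Real.negMulLog_mul]
  ring

lemma strictConcaveOn_negMulLogTwo : StrictConcaveOn ℝ (Set.Ici (0 : ℝ)) negMulLogTwo := by
  have hlog : (0 : ℝ) < (Real.log 2)⁻¹ := inv_pos.2 (Real.log_pos one_lt_two)
  refine ⟨convex_Ici 0, fun x hx y hy hxy a b ha hb hab => ?_⟩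
  have h := mul_lt_mul_of_pos_left (Real.strictConcaveOn_negMulLog.2 hx hy hxy ha hb hab) hlog
  simp only [negMulLogTwo_eq, smul_eq_mul] at *
  linarith

variable {ι : Type*} [Fintype ι]

lemma strictConcaveOn_sum_comp {E : Type*} [AddCommMonoid E] [Module ℝ E] {s : Set E} {φ : E → ℝ}
    (hφ : StrictConcaveOn ℝ s φ) :
    StrictConcaveOn ℝ (Set.univ.pi fun _ : ι => s) fun p => ∑ i, φ (p i) := by
  refine ⟨convex_pi fun _ _ => hφ.1, fun p hp q hq hpq a b ha hb hab => ?_⟩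
  obtain ⟨i, hi⟩ := Function.ne_iff.1 hpq
  simp only [Finset.smul_sum, ← Finset.sum_add_distrib]
  exact Finset.sum_lt_sum
    (fun i _ => hφ.concaveOn.2 (hp i trivial) (hq i trivial) ha.le hb.le hab)
    ⟨i, Finset.mem_univ i, hφ.2 (hp i trivial) (hq i trivial) hi ha hb hab⟩

end Entropy

section VonNeumann

open scoped ComplexOrder

variable {ι R I : Type*} [Fintype ι] [DecidableEq ι] [Fintype R] [DecidableEq R]
  [Fintype I] [DecidableEq I]

lemma vonNeumannEntropy_diagonal (d : ι → ℂ) :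
    vonNeumannEntropy (Matrix.diagonal d) = ∑ i, negMulLogTwo (d i).re := by
  unfold vonNeumannEntropy
  rw [Matrix.charpoly_diagonal, Polynomial.roots_prod _ _
    (Finset.prod_ne_zero_iff.2 fun i _ => Polynomial.X_sub_C_ne_zero _)]
  simp [negMulLogTwo]

lemma charmatrix_blockDiagonal (N : I → Matrix R R ℂ) :
    (Matrix.blockDiagonal N).charmatrix = Matrix.blockDiagonal fun i => (N i).charmatrix := by
  ext ⟨r, i⟩ ⟨s, j⟩
  by_cases hij : i = j <;> by_cases hrs : r = s <;> simp [Matrix.blockDiagonal_apply, hij, hrs]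

lemma vonNeumannEntropy_blockDiagonal (N : I → Matrix R R ℂ) :
    vonNeumannEntropy (Matrix.blockDiagonal N) = ∑ i, vonNeumannEntropy (N i) := by
  have hchar : (Matrix.blockDiagonal N).charpoly = ∏ i, (N i).charpoly := by
    rw [Matrix.charpoly, charmatrix_blockDiagonal, Matrix.det_blockDiagonal]
    rfl
  unfold vonNeumannEntropy
  rw [hchar, Polynomial.roots_prod _ _
    (Finset.prod_ne_zero_iff.2 fun i _ => (Matrix.charpoly_monic _).ne_zero),
    Multiset.map_bind, Multiset.sum_bind]
  rfl

lemma vonNeumannEntropy_unitary_conj (U : Matrix.unitaryGroup ι ℂ) (A : Matrix ι ι ℂ) :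
    vonNeumannEntropy (U.1 * A * star U.1) = vonNeumannEntropy A := by
  unfold vonNeumannEntropy
  rw [Matrix.charpoly_mul_comm, ← mul_assoc, Unitary.star_mul_self_of_mem U.2, one_mul]

lemma exists_unitary_conj_diagonal {A : Matrix ι ι ℂ} (hA : A.PosSemidef) :
    ∃ (U : Matrix.unitaryGroup ι ℂ) (d : ι → ℝ), (∀ i, 0 ≤ d i) ∧
      A = U.1 * Matrix.diagonal (fun i => (d i : ℂ)) * star U.1 := by
  refine ⟨hA.1.eigenvectorUnitary, hA.1.eigenvalues, hA.eigenvalues_nonneg, ?_⟩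
  conv_lhs => rw [hA.1.spectral_theorem]
  rw [Unitary.conjStarAlgAut_apply]
  rfl

lemma vonNeumannEntropy_smul (a : ℝ) {A : Matrix ι ι ℂ} (hA : A.PosSemidef) :
    vonNeumannEntropy (a • A) = a * vonNeumannEntropy A + negMulLogTwo a * A.trace.re := by
  obtain ⟨U, d, -, rfl⟩ := exists_unitary_conj_diagonal hA
  have hsmul : a • (U.1 * Matrix.diagonal (fun i => (d i : ℂ)) * star U.1)
      = U.1 * Matrix.diagonal (fun i => ((a * d i : ℝ) : ℂ)) * star U.1 := by
    rw [← Matrix.smul_mul, ← Matrix.mul_smul, ← Matrix.diagonal_smul]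
    simp [Pi.smul_def]
  rw [hsmul, vonNeumannEntropy_unitary_conj, vonNeumannEntropy_unitary_conj,
    vonNeumannEntropy_diagonal, vonNeumannEntropy_diagonal, Matrix.trace_mul_comm, ← mul_assoc,
    Unitary.star_mul_self_of_mem U.2, one_mul, Matrix.trace_diagonal]
  simp only [Complex.ofReal_re, negMulLogTwo_mul, Complex.re_sum, Finset.sum_add_distrib,
    Finset.mul_sum]

lemma sum_normSq_row (U : Matrix.unitaryGroup ι ℂ) (i : ι) :
    ∑ j, Complex.normSq (U.1 i j) = 1 := by
  have h : (U.1 * star U.1) i i = 1 := by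
    rw [Unitary.mul_star_self_of_mem U.2, Matrix.one_apply_eq]
  simp only [Matrix.mul_apply, Matrix.star_apply, Complex.star_def,
    Complex.mul_conj] at h
  exact_mod_cast h

lemma sum_normSq_col (U : Matrix.unitaryGroup ι ℂ) (j : ι) :
    ∑ i, Complex.normSq (U.1 i j) = 1 := by
  have h : (star U.1 * U.1) j j = 1 := by
    rw [Unitary.star_mul_self_of_mem U.2, Matrix.one_apply_eq]
  simp only [Matrix.mul_apply, Matrix.star_apply, Complex.star_def,
    ← Complex.normSq_eq_conj_mul_self] at h
  exact_mod_cast h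

lemma unitary_conj_diagonal_apply_re (U : Matrix ι ι ℂ) (d : ι → ℝ) (i : ι) :
    ((U * Matrix.diagonal (fun i => (d i : ℂ)) * star U) i i).re
      = ∑ j, Complex.normSq (U i j) * d j := by
  rw [Matrix.mul_apply, Complex.re_sum]
  refine Finset.sum_congr rfl fun j _ => ?_
  rw [Matrix.mul_diagonal, Matrix.star_apply, mul_right_comm, Complex.star_def, Complex.mul_conj,
    ← Complex.ofReal_mul, Complex.ofReal_re]

lemma vonNeumannEntropy_unitary_conj_diagonal (U : Matrix.unitaryGroup ι ℂ) (d : ι → ℝ) :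
    vonNeumannEntropy (U.1 * Matrix.diagonal (fun i => (d i : ℂ)) * star U.1)
      = ∑ i, ∑ j, Complex.normSq (U.1 i j) * negMulLogTwo (d j) := by
  rw [vonNeumannEntropy_unitary_conj, vonNeumannEntropy_diagonal, Finset.sum_comm]
  simp only [← Finset.sum_mul, sum_normSq_col, one_mul, Complex.ofReal_re]

lemma sum_normSq_mul_negMulLogTwo_le (U : Matrix.unitaryGroup ι ℂ) {d : ι → ℝ}
    (hd : ∀ i, 0 ≤ d i) (i : ι) :
    ∑ j, Complex.normSq (U.1 i j) * negMulLogTwo (d j)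
      ≤ negMulLogTwo (∑ j, Complex.normSq (U.1 i j) * d j) :=
  strictConcaveOn_negMulLogTwo.concaveOn.le_map_sum (fun _ _ => Complex.normSq_nonneg _)
    (sum_normSq_row U i) fun j _ => hd j

lemma vonNeumannEntropy_le_sum_diag {A : Matrix ι ι ℂ} (hA : A.PosSemidef) :
    vonNeumannEntropy A ≤ ∑ i, negMulLogTwo (A i i).re := by
  obtain ⟨U, d, hd, rfl⟩ := exists_unitary_conj_diagonal hA
  simp only [vonNeumannEntropy_unitary_conj_diagonal, unitary_conj_diagonal_apply_re]
  exact Finset.sum_le_sum fun i _ => sum_normSq_mul_negMulLogTwo_le U hd i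

lemma eq_diagonal_of_sum_diag_le {A : Matrix ι ι ℂ} (hA : A.PosSemidef)
    (h : ∑ i, negMulLogTwo (A i i).re ≤ vonNeumannEntropy A) :
    A = Matrix.diagonal fun i => ((A i i).re : ℂ) := by
  replace h := (vonNeumannEntropy_le_sum_diag hA).antisymm h
  obtain ⟨U, d, hd, rfl⟩ := exists_unitary_conj_diagonal hA
  simp only [vonNeumannEntropy_unitary_conj_diagonal, unitary_conj_diagonal_apply_re] at h ⊢
  have hJensen := (Finset.sum_eq_sum_iff_of_le fun i _ => sum_normSq_mul_negMulLogTwo_le U hd i).1 h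
  have heigen (i j : ι) (hij : U.1 i j ≠ 0) : d j = ∑ j, Complex.normSq (U.1 i j) * d j :=
    (strictConcaveOn_negMulLogTwo.map_sum_eq_iff' (fun _ _ => Complex.normSq_nonneg _)
      (sum_normSq_row U i) fun j _ => hd j).1 (hJensen i (Finset.mem_univ i)).symm j
      (Finset.mem_univ j) (by simpa using hij)
  have hcomm : U.1 * Matrix.diagonal (fun j => (d j : ℂ))
      = Matrix.diagonal (fun i => ((∑ j, Complex.normSq (U.1 i j) * d j : ℝ) : ℂ)) * U.1 := by
    ext i j
    rw [Matrix.mul_diagonal, Matrix.diagonal_mul, mul_comm]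
    by_cases hij : U.1 i j = 0
    · rw [hij, mul_zero, mul_zero]
    · rw [heigen i j hij]
  rw [hcomm, mul_assoc, Unitary.mul_star_self_of_mem U.2, mul_one]

/-- Diagonalising `a • A + b • B` reduces the strict concavity of the entropy to this case, where
the entropies of `A` and `B` are compared with those of their diagonals. -/
lemma eq_of_smul_add_smul_eq_diagonal {A B : Matrix ι ι ℂ} (hA : A.PosSemidef)
    (hB : B.PosSemidef) {a b : ℝ} (ha : 0 < a) (hb : 0 < b) (hab : a + b = 1) {d : ι → ℝ}
    (hd : a • A + b • B = Matrix.diagonal fun i => (d i : ℂ))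
    (h : vonNeumannEntropy (a • A + b • B) ≤ a * vonNeumannEntropy A + b * vonNeumannEntropy B) :
    A = B := by
  let p : ι → ℝ := fun i => (A i i).re
  let q : ι → ℝ := fun i => (B i i).re
  have hp : p ∈ Set.univ.pi fun _ => Set.Ici (0 : ℝ) := fun i _ =>
    (Complex.le_def.1 hA.diag_nonneg).1
  have hq : q ∈ Set.univ.pi fun _ => Set.Ici (0 : ℝ) := fun i _ =>
    (Complex.le_def.1 hB.diag_nonneg).1
  have hdpq : d = a • p + b • q := by
    ext i
    simpa [p, q] using (congrArg Complex.re (congrFun (congrFun hd i) i)).symm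
  have hsum : vonNeumannEntropy (a • A + b • B) = ∑ i, negMulLogTwo ((a • p + b • q) i) := by
    rw [hd, vonNeumannEntropy_diagonal, ← hdpq]
    rfl
  have hconcave := strictConcaveOn_sum_comp (ι := ι) strictConcaveOn_negMulLogTwo
  have hle := hconcave.concaveOn.2 hp hq ha.le hb.le hab
  simp only [smul_eq_mul] at hle
  have hleA := mul_le_mul_of_nonneg_left (vonNeumannEntropy_le_sum_diag hA) ha.le
  have hleB := mul_le_mul_of_nonneg_left (vonNeumannEntropy_le_sum_diag hB) hb.le
  have hA' := eq_diagonal_of_sum_diag_le hA (le_of_mul_le_mul_left (by linarith) ha)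
  have hB' := eq_diagonal_of_sum_diag_le hB (le_of_mul_le_mul_left (by linarith) hb)
  have hpq : p = q := by
    by_contra hne
    have hlt := hconcave.2 hp hq hne ha hb hab
    simp only [smul_eq_mul] at hlt
    linarith
  rw [hA', hB']
  exact congrArg (fun v : ι → ℝ => Matrix.diagonal fun i => (v i : ℂ)) hpq

lemma strictConcaveOn_vonNeumannEntropy :
    StrictConcaveOn ℝ {A : Matrix ι ι ℂ | A.PosSemidef} vonNeumannEntropy := by
  refine ⟨fun A hA B hB a b ha hb _ => (hA.smul ha).add (hB.smul hb),
    fun A hA B hB hAB a b ha hb hab => lt_of_not_ge fun h => hAB ?_⟩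
  obtain ⟨U, d, -, hd⟩ := exists_unitary_conj_diagonal ((hA.smul ha.le).add (hB.smul hb.le))
  have hconj (C : Matrix ι ι ℂ) : U.1 * (star U.1 * C * U.1) * star U.1 = C := by
    rw [← mul_assoc, ← mul_assoc, Unitary.mul_star_self_of_mem U.2, one_mul, mul_assoc,
      Unitary.mul_star_self_of_mem U.2, mul_one]
  have hent (C : Matrix ι ι ℂ) : vonNeumannEntropy (star U.1 * C * U.1) = vonNeumannEntropy C := by
    rw [← vonNeumannEntropy_unitary_conj U, hconj]
  have hlin : a • (star U.1 * A * U.1) + b • (star U.1 * B * U.1)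
      = star U.1 * (a • A + b • B) * U.1 := by
    simp only [mul_add, add_mul, Matrix.mul_smul, Matrix.smul_mul]
  have hdiag : star U.1 * (a • A + b • B) * U.1 = Matrix.diagonal fun i => (d i : ℂ) := by
    rw [hd, ← mul_assoc, ← mul_assoc, Unitary.star_mul_self_of_mem U.2, one_mul, mul_assoc,
      Unitary.star_mul_self_of_mem U.2, mul_one]
  have heq := eq_of_smul_add_smul_eq_diagonal (hA.conjTranspose_mul_mul_same U.1)
    (hB.conjTranspose_mul_mul_same U.1) ha hb hab (hlin.trans hdiag) (by
      change vonNeumannEntropy (a • (star U.1 * A * U.1) + b • (star U.1 * B * U.1))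
        ≤ a * vonNeumannEntropy (star U.1 * A * U.1) + b * vonNeumannEntropy (star U.1 * B * U.1)
      rw [hlin, hent, hent, hent]
      exact h)
  rw [← hconj A, ← hconj B]
  exact congrArg (fun C => U.1 * C * star U.1) heq

end VonNeumann

/-! # Information divulged by quantum registers -/

section Holevo

open scoped ComplexOrder

variable {P Q C : Type*} [Fintype P]

/-- Density matrices: the states of a quantum register with basis `P`. -/
structure IsDensityMatrix (ρ : Matrix P P ℂ) : Prop where
  posSemidef : ρ.PosSemidef
  trace_eq_one : ρ.trace = 1

variable [DecidableEq P] [Fintype Q] [Fintype C]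

/-- The Holevo information `I(P : Q)` of a classical index `q : Q` and a register that is in the
state `N q`. The states need not be normalised: the trace of `N q` is the weight of `q`. -/
noncomputable def holevoInfo (N : Q → Matrix P P ℂ) : ℝ :=
  vonNeumannEntropy (∑ q, N q) + ∑ q, negMulLogTwo (N q).trace.re
    - negMulLogTwo (∑ q, (N q).trace).re - ∑ q, vonNeumannEntropy (N q)

lemma quantumCondMutualInfo_blockDiagonal [DecidableEq Q] [DecidableEq C]
    (N : Q × C → Matrix P P ℂ) :
    quantumCondMutualInfo (Matrix.blockDiagonal N) = ∑ c, holevoInfo fun q => N (q, c) := by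
  have hPC : (Matrix.of fun (i j : P × C) =>
      ∑ q : Q, Matrix.blockDiagonal N (i.1, q, i.2) (j.1, q, j.2))
      = Matrix.blockDiagonal fun c => ∑ q, N (q, c) := by
    ext i j
    by_cases h : i.2 = j.2 <;> simp [Matrix.blockDiagonal_apply, Matrix.sum_apply, h]
  have hQC : (Matrix.of fun (i j : Q × C) =>
      ∑ p : P, Matrix.blockDiagonal N (p, i.1, i.2) (p, j.1, j.2))
      = Matrix.diagonal fun i => (N i).trace := by
    ext i j
    by_cases h : i = j <;> simp [Matrix.blockDiagonal_apply, Matrix.trace, h]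
  have hC : (Matrix.of fun (i j : C) =>
      ∑ p : P, ∑ q : Q, Matrix.blockDiagonal N (p, q, i) (p, q, j))
      = Matrix.diagonal fun c => ∑ q, (N (q, c)).trace := by
    ext i j
    rw [Matrix.of_apply, Finset.sum_comm]
    by_cases h : i = j <;> simp [Matrix.blockDiagonal_apply, Matrix.trace, h]
  unfold quantumCondMutualInfo holevoInfo
  rw [hPC, hQC, hC, vonNeumannEntropy_blockDiagonal, vonNeumannEntropy_blockDiagonal,
    vonNeumannEntropy_diagonal, vonNeumannEntropy_diagonal, Fintype.sum_prod_type_right,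
    Fintype.sum_prod_type_right]
  simp only [Finset.sum_add_distrib, Finset.sum_sub_distrib]

variable {w : Q → ℝ} {σ : Q → Matrix P P ℂ}

lemma holevoInfo_smul (hw : ∀ q, 0 ≤ w q) (hσ : ∀ q, IsDensityMatrix (σ q)) :
    holevoInfo (fun q => w q • σ q) = (∑ q, w q)
      * (vonNeumannEntropy (∑ q, (w q / ∑ q, w q) • σ q)
        - ∑ q, (w q / ∑ q, w q) * vonNeumannEntropy (σ q)) := by
  set s := ∑ q, w q with hs
  have hw_eq (q : Q) : w q = s * (w q / s) := by
    obtain hs0 | hs0 := eq_or_ne s 0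
    · rw [hs0, (Finset.sum_eq_zero_iff_of_nonneg fun q _ => hw q).1 hs0 q (Finset.mem_univ q),
        zero_mul]
    · rw [mul_div_cancel₀ _ hs0]
  have hs_nonneg : 0 ≤ s := Finset.sum_nonneg fun q _ => hw q
  have hpsd : (∑ q, (w q / s) • σ q).PosSemidef :=
    Matrix.posSemidef_sum _ fun q _ => (hσ q).posSemidef.smul (div_nonneg (hw q) hs_nonneg)
  have htrace : (∑ q, w q • σ q).trace.re = s := by
    simp [Matrix.trace_sum, Matrix.trace_smul, (hσ _).trace_eq_one, hs]
  have hsum : ∑ q, w q • σ q = s • ∑ q, (w q / s) • σ q := by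
    simp only [Finset.smul_sum, smul_smul, ← hw_eq]
  have htrace' : negMulLogTwo s * (∑ q, (w q / s) • σ q).trace.re = negMulLogTwo s := by
    obtain hs0 | hs0 := eq_or_ne s 0
    · rw [hs0, negMulLogTwo_zero, zero_mul]
    · rw [hsum, Matrix.trace_smul, Complex.smul_re, smul_eq_mul] at htrace
      rw [mul_left_cancel₀ hs0 (htrace.trans (mul_one s).symm), mul_one]
  have hmix : vonNeumannEntropy (∑ q, w q • σ q)
      = s * vonNeumannEntropy (∑ q, (w q / s) • σ q) + negMulLogTwo s := by
    rw [hsum, vonNeumannEntropy_smul s hpsd, htrace']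
  unfold holevoInfo
  rw [hmix, ← Matrix.trace_sum, htrace]
  simp only [vonNeumannEntropy_smul _ (hσ _).posSemidef, Matrix.trace_smul, (hσ _).trace_eq_one,
    Complex.smul_re, Complex.one_re, smul_eq_mul, mul_one, Finset.sum_add_distrib, mul_sub,
    Finset.mul_sum, ← mul_assoc, ← hw_eq]
  ring

lemma sum_div_sum_eq_one (hs : ∑ q, w q ≠ 0) : ∑ q, w q / ∑ q, w q = 1 := by
  rw [← Finset.sum_div, div_self hs]

lemma holevoInfo_smul_nonneg (hw : ∀ q, 0 ≤ w q) (hσ : ∀ q, IsDensityMatrix (σ q)) :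
    0 ≤ holevoInfo fun q => w q • σ q := by
  have hs : 0 ≤ ∑ q, w q := Finset.sum_nonneg fun q _ => hw q
  rw [holevoInfo_smul hw hσ]
  obtain hs0 | hs0 := eq_or_ne (∑ q, w q) 0
  · rw [hs0, zero_mul]
  · exact mul_nonneg hs (sub_nonneg.2 (strictConcaveOn_vonNeumannEntropy.concaveOn.le_map_sum
      (fun q _ => div_nonneg (hw q) hs) (sum_div_sum_eq_one hs0) fun q _ => (hσ q).posSemidef))

lemma holevoInfo_smul_eq_zero_iff (hw : ∀ q, 0 ≤ w q) (hσ : ∀ q, IsDensityMatrix (σ q)) :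
    holevoInfo (fun q => w q • σ q) = 0 ↔ ∀ q q', w q ≠ 0 → w q' ≠ 0 → σ q = σ q' := by
  have hs : 0 ≤ ∑ q, w q := Finset.sum_nonneg fun q _ => hw q
  rw [holevoInfo_smul hw hσ]
  obtain hs0 | hs0 := eq_or_ne (∑ q, w q) 0
  · have hw0 (q : Q) : w q = 0 :=
      (Finset.sum_eq_zero_iff_of_nonneg fun q _ => hw q).1 hs0 q (Finset.mem_univ q)
    simp [hw0]
  · have hJensen := strictConcaveOn_vonNeumannEntropy.map_sum_eq_iff_of_nonneg
      (fun q _ => div_nonneg (hw q) hs) (sum_div_sum_eq_one hs0)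
      fun q (_ : q ∈ Finset.univ) => (hσ q).posSemidef
    simp only [smul_eq_mul, Finset.mem_univ, true_implies, ne_eq, div_eq_zero_iff, hs0,
      or_false] at hJensen
    rw [mul_eq_zero_iff_left hs0, sub_eq_zero, hJensen]
    exact ⟨fun h q q' hq hq' => h hq hq', fun h q hq q' hq' => h q q' hq hq'⟩

end Holevo

section QuantumDivulged

variable {R O K Z : Type*} [Fintype R] [Fintype O] [Fintype K]
  {g : O → K → Z} {σ : O → K → Matrix R R ℂ} {μ : O → K → ℝ}

open Classical in
/-- Given the own input and the value of the function, the other input is distributed according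
to the restriction of `μ` to the inputs that are compatible with them. -/
lemma quantumDivulged_eq_sum_holevoInfo :
    quantumDivulged g σ μ = ∑ c : K × Set.range (fun a : O × K => g a.1 a.2),
      holevoInfo fun o => (if (c.2 : Z) = g o c.1 then μ o c.1 else 0) • σ o c.1 := by
  rw [quantumDivulged, ← quantumCondMutualInfo_blockDiagonal
    fun i : O × K × Set.range (fun a : O × K => g a.1 a.2) =>
      (if (i.2.2 : Z) = g i.1 i.2.1 then μ i.1 i.2.1 else 0) • σ i.1 i.2.1]
  congr 1
  ext ⟨r, i⟩ ⟨s, j⟩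
  rw [Matrix.of_apply, Matrix.blockDiagonal_apply]
  by_cases hij : i = j <;> by_cases hz : (i.2.2 : Z) = g i.1 i.2.1 <;> simp [hij, hz]

lemma quantumDivulged_nonneg (hσ : ∀ o k, IsDensityMatrix (σ o k)) (hμ : ∀ o k, 0 ≤ μ o k) :
    0 ≤ quantumDivulged g σ μ := by
  classical
  rw [quantumDivulged_eq_sum_holevoInfo]
  exact Finset.sum_nonneg fun c _ =>
    holevoInfo_smul_nonneg (fun o => by split_ifs <;> simp [hμ]) fun o => hσ o c.1

lemma quantumDivulged_eq_zero_iff (hσ : ∀ o k, IsDensityMatrix (σ o k)) (hμ : ∀ o k, 0 ≤ μ o k) :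
    quantumDivulged g σ μ = 0 ↔
      ∀ k o o', g o k = g o' k → μ o k ≠ 0 → μ o' k ≠ 0 → σ o k = σ o' k := by
  classical
  have hw (c : K × Set.range (fun a : O × K => g a.1 a.2)) (o : O) :
      0 ≤ if (c.2 : Z) = g o c.1 then μ o c.1 else 0 := by
    split_ifs <;> simp [hμ]
  rw [quantumDivulged_eq_sum_holevoInfo, Finset.sum_eq_zero_iff_of_nonneg fun c _ =>
    holevoInfo_smul_nonneg (hw c) fun o => hσ o c.1]
  simp only [holevoInfo_smul_eq_zero_iff (hw _) fun o => hσ o _, Finset.mem_univ, true_implies,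
    ne_eq, ite_eq_right_iff, not_forall, exists_prop]
  constructor
  · intro h k o o' hg ho ho'
    exact h (k, ⟨g o k, (o, k), rfl⟩) o o' ⟨rfl, ho⟩ ⟨hg, ho'⟩
  · rintro h ⟨k, z⟩ o o' ⟨hz, ho⟩ ⟨hz', ho'⟩
    exact h k o o' (hz.symm.trans hz') ho ho'

end QuantumDivulged

/-! # Information divulged by classical views -/

section Shannon

open scoped ComplexOrder

open Classical in
/-- The probability that `W = w`. -/
noncomputable def massAt {Ω α : Type*} [Fintype Ω] (pr : Ω → ℝ) (W : Ω → α) (w : α) : ℝ :=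
  ∑ ω, if W ω = w then pr ω else 0

variable {Ω α β γ α' γ' : Type*} [Fintype Ω] {pr : Ω → ℝ}

lemma massAt_nonneg (h : ∀ ω, 0 ≤ pr ω) (W : Ω → α) (w : α) : 0 ≤ massAt pr W w :=
  Finset.sum_nonneg fun ω _ => by
    split_ifs
    exacts [h ω, le_rfl]

lemma massAt_eq_zero {W : Ω → α} {w : α} (h : ∀ ω, W ω ≠ w) : massAt pr W w = 0 := by
  simp [massAt, h]

lemma massAt_congr {W : Ω → α} {w : α} {W' : Ω → β} {w' : β} (h : ∀ ω, W ω = w ↔ W' ω = w') :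
    massAt pr W w = massAt pr W' w' :=
  Finset.sum_congr rfl fun ω _ => by classical exact if_congr (h ω) rfl rfl

lemma massAt_comp_of_injective {e : α → β} (he : e.Injective) (W : Ω → α) (w : α) :
    massAt pr (e ∘ W) (e w) = massAt pr W w :=
  massAt_congr fun _ => he.eq_iff

lemma sum_massAt [Fintype α] (W : Ω → α) : ∑ w, massAt pr W w = ∑ ω, pr ω := by
  classical
  simp only [massAt]
  rw [Finset.sum_comm]
  simp

lemma sum_massAt_prodMk_left [Fintype β] (V : Ω → β) (W : Ω → γ) (w : γ) :
    ∑ v, massAt pr (fun ω => (V ω, W ω)) (v, w) = massAt pr W w := by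
  classical
  simp only [massAt]
  rw [Finset.sum_comm]
  simp [ite_and]

lemma sum_massAt_prodMk_middle [Fintype β] (U : Ω → α) (V : Ω → β) (W : Ω → γ) (u : α) (w : γ) :
    ∑ v, massAt pr (fun ω => (U ω, V ω, W ω)) (u, v, w)
      = massAt pr (fun ω => (U ω, W ω)) (u, w) := by
  classical
  simp only [massAt]
  rw [Finset.sum_comm]
  simp [ite_and]

lemma shannonEntropy_eq_sum_image [DecidableEq α] (W : Ω → α) :
    shannonEntropy pr W = ∑ w ∈ Finset.univ.image W, negMulLogTwo (massAt pr W w) := by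
  unfold shannonEntropy massAt negMulLogTwo
  congr!

lemma shannonEntropy_eq_sum [Fintype α] (W : Ω → α) :
    shannonEntropy pr W = ∑ w, negMulLogTwo (massAt pr W w) := by
  classical
  rw [shannonEntropy_eq_sum_image]
  refine Finset.sum_subset (Finset.subset_univ _) fun w _ hw => ?_
  rw [massAt_eq_zero fun ω h => hw (Finset.mem_image.2 ⟨ω, Finset.mem_univ _, h⟩),
    negMulLogTwo_zero]

lemma shannonEntropy_comp_of_injective {e : α → β} (he : e.Injective) (W : Ω → α) :
    shannonEntropy pr (e ∘ W) = shannonEntropy pr W := by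
  classical
  rw [shannonEntropy_eq_sum_image, shannonEntropy_eq_sum_image, ← Finset.image_image,
    Finset.sum_image he.injOn]
  simp only [massAt_comp_of_injective he]

lemma condMutualInfo_comp_of_injective {e : α → α'} {e' : γ → γ'} (he : e.Injective)
    (he' : e'.Injective) (U : Ω → α) (V : Ω → β) (W : Ω → γ) :
    condMutualInfo pr (e ∘ U) V (e' ∘ W) = condMutualInfo pr U V W := by
  simp only [condMutualInfo]
  congr 1
  · congr 1
    · congr 1
      · exact shannonEntropy_comp_of_injective (he.prodMap he') fun ω => (U ω, W ω)
      · exact shannonEntropy_comp_of_injective (Function.injective_id.prodMap he')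
          fun ω => (V ω, W ω)
    · exact shannonEntropy_comp_of_injective he' W
  · exact shannonEntropy_comp_of_injective (he.prodMap (Function.injective_id.prodMap he'))
      fun ω => (U ω, V ω, W ω)

lemma holevoInfo_diagonal [Fintype α] [DecidableEq α] [Fintype β] (p : β → α → ℝ) :
    holevoInfo (fun v => Matrix.diagonal fun u => (p v u : ℂ))
      = ∑ u, negMulLogTwo (∑ v, p v u) + ∑ v, negMulLogTwo (∑ u, p v u)
        - negMulLogTwo (∑ v, ∑ u, p v u) - ∑ v, ∑ u, negMulLogTwo (p v u) := by
  have hsum : ∑ v, Matrix.diagonal (fun u => (p v u : ℂ))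
      = Matrix.diagonal fun u => ((∑ v, p v u : ℝ) : ℂ) := by
    ext u u'
    by_cases h : u = u' <;> simp [Matrix.sum_apply, h]
  simp only [holevoInfo, hsum, vonNeumannEntropy_diagonal, Matrix.trace_diagonal,
    ← Complex.ofReal_sum, Complex.ofReal_re]

lemma condMutualInfo_eq_sum_holevoInfo [Fintype α] [DecidableEq α] [Fintype β] [Fintype γ]
    (U : Ω → α) (V : Ω → β) (W : Ω → γ) :
    condMutualInfo pr U V W = ∑ w, holevoInfo fun v =>
      Matrix.diagonal fun u => (massAt pr (fun ω => (U ω, V ω, W ω)) (u, v, w) : ℂ) := by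
  simp only [holevoInfo_diagonal, sum_massAt_prodMk_left, sum_massAt_prodMk_middle, condMutualInfo,
    shannonEntropy_eq_sum, Finset.sum_add_distrib, Finset.sum_sub_distrib, Fintype.sum_prod_type]
  congr 1
  · congr 1
    congr 1 <;> exact Finset.sum_comm
  · exact ((Finset.sum_congr rfl fun _ _ => Finset.sum_comm).trans Finset.sum_comm).trans
      (Finset.sum_congr rfl fun _ _ => Finset.sum_comm)

variable {I N O K Z : Type*} [Fintype I] [Fintype N] {g : O → K → Z} {μ : I → ℝ} {ν : N → ℝ}

/-- A classical view is a quantum register that is always in a computational basis state, so its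
joint state with the inputs is diagonal. -/
lemma condMutualInfo_eq_quantumDivulged [Fintype O] [Fintype K] [Fintype α] [DecidableEq α]
    (e : I ≃ O × K) (U : I × N → α) :
    condMutualInfo (fun ω : I × N => μ ω.1 * ν ω.2) U (fun ω => (e ω.1).1)
        (fun ω => ((e ω.1).2, g (e ω.1).1 (e ω.1).2))
      = quantumDivulged g
        (fun o k => Matrix.diagonal fun u => (massAt ν (fun n => U (e.symm (o, k), n)) u : ℂ))
        (fun o k => μ (e.symm (o, k))) := by
  classical
  let W : I × N → K × Set.range (fun a : O × K => g a.1 a.2) := fun ω =>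
    ((e ω.1).2, ⟨g (e ω.1).1 (e ω.1).2, e ω.1, rfl⟩)
  have hmass (u : α) (o : O) (c : K × Set.range (fun a : O × K => g a.1 a.2)) :
      massAt (fun ω : I × N => μ ω.1 * ν ω.2) (fun ω => (U ω, (e ω.1).1, W ω)) (u, o, c)
        = (if (c.2 : Z) = g o c.1 then μ (e.symm (o, c.1)) else 0)
          * massAt ν (fun n => U (e.symm (o, c.1), n)) u := by
    obtain ⟨k, z, hz⟩ := c
    simp only [massAt, Fintype.sum_prod_type]
    rw [← e.symm.sum_comp, Fintype.sum_eq_single (o, k)]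
    · simp only [W, e.apply_symm_apply, Prod.mk.injEq, Subtype.mk.injEq, true_and,
        @eq_comm _ _ z, and_comm, ite_and, Finset.mul_sum, mul_ite, mul_zero]
      split_ifs <;> simp
    · intro i hi
      refine Finset.sum_eq_zero fun n _ => if_neg fun h => hi ?_
      simp only [W, e.apply_symm_apply, Prod.mk.injEq] at h
      exact Prod.ext h.2.1 h.2.2.1
  change condMutualInfo _ (id ∘ U) _ (Prod.map id Subtype.val ∘ W) = _
  rw [condMutualInfo_comp_of_injective Function.injective_id
    (Function.injective_id.prodMap Subtype.val_injective), condMutualInfo_eq_sum_holevoInfo,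
    quantumDivulged_eq_sum_holevoInfo]
  congr! with c _ o
  ext u u'
  obtain rfl | h := eq_or_ne u u'
  · rw [Matrix.diagonal_apply_eq, hmass, Matrix.smul_apply, Matrix.diagonal_apply_eq,
      Complex.real_smul, Complex.ofReal_mul]
  · simp [h]

lemma isDensityMatrix_diagonal_massAt [Fintype α] [DecidableEq α] (hν : ν ∈ stdSimplex ℝ N)
    (U : N → α) : IsDensityMatrix (Matrix.diagonal fun u => (massAt ν U u : ℂ)) where
  posSemidef :=
    Matrix.PosSemidef.diagonal fun u => Complex.zero_le_real.2 (massAt_nonneg hν.1 U u)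
  trace_eq_one := by
    rw [Matrix.trace_diagonal, ← Complex.ofReal_sum, sum_massAt, hν.2, Complex.ofReal_one]

variable [Finite O] [Finite K]

lemma condMutualInfo_nonneg (e : I ≃ O × K) (hμ : ∀ i, 0 ≤ μ i) (hν : ν ∈ stdSimplex ℝ N)
    (U : I × N → α) :
    0 ≤ condMutualInfo (fun ω : I × N => μ ω.1 * ν ω.2) U (fun ω => (e ω.1).1)
        (fun ω => ((e ω.1).2, g (e ω.1).1 (e ω.1).2)) := by
  classical
  cases nonempty_fintype O
  cases nonempty_fintype K
  change 0 ≤ condMutualInfo _ (Subtype.val ∘ Set.rangeFactorization U) _ (id ∘ _)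
  rw [condMutualInfo_comp_of_injective Subtype.val_injective Function.injective_id,
    condMutualInfo_eq_quantumDivulged]
  exact quantumDivulged_nonneg (fun o k => isDensityMatrix_diagonal_massAt hν _) fun o k => hμ _

lemma condMutualInfo_eq_zero_iff (e : I ≃ O × K) (hμ : ∀ i, 0 ≤ μ i) (hν : ν ∈ stdSimplex ℝ N)
    (U : I × N → α) :
    condMutualInfo (fun ω : I × N => μ ω.1 * ν ω.2) U (fun ω => (e ω.1).1)
        (fun ω => ((e ω.1).2, g (e ω.1).1 (e ω.1).2)) = 0 ↔
      ∀ k o o', g o k = g o' k → μ (e.symm (o, k)) ≠ 0 → μ (e.symm (o', k)) ≠ 0 →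
        massAt ν (fun n => U (e.symm (o, k), n)) = massAt ν (fun n => U (e.symm (o', k), n)) := by
  classical
  cases nonempty_fintype O
  cases nonempty_fintype K
  change condMutualInfo _ (Subtype.val ∘ Set.rangeFactorization U) _ (id ∘ _) = 0 ↔ _
  rw [condMutualInfo_comp_of_injective Subtype.val_injective Function.injective_id,
    condMutualInfo_eq_quantumDivulged, quantumDivulged_eq_zero_iff
    (fun o k => isDensityMatrix_diagonal_massAt hν _) fun o k => hμ _]
  have hmass (i : I) (u : Set.range U) :
      massAt ν (fun n => U (i, n)) u
        = massAt ν (fun n => Set.rangeFactorization U (i, n)) u :=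
    massAt_comp_of_injective Subtype.val_injective (fun n => Set.rangeFactorization U (i, n)) u
  refine forall₃_congr fun k o o' => forall₃_congr fun _ _ _ => ?_
  rw [Matrix.diagonal_injective.eq_iff, funext_iff, funext_iff]
  simp only [Complex.ofReal_inj, ← hmass]
  refine ⟨fun h u => ?_, fun h u => h u⟩
  by_cases hu : u ∈ Set.range U
  · exact h ⟨u, hu⟩
  · rw [massAt_eq_zero, massAt_eq_zero] <;> exact fun n hn => hu ⟨_, hn⟩

end Shannon

/-! # Local unitary transformations -/

section Purification

open Matrix

lemma exists_linearIsometry_comp_eq {𝕜 E F : Type*} [RCLike 𝕜] [AddCommGroup E] [Module 𝕜 E]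
    [NormedAddCommGroup F] [InnerProductSpace 𝕜 F] [FiniteDimensional 𝕜 F] {f g : E →ₗ[𝕜] F}
    (h : ∀ v, ‖f v‖ = ‖g v‖) : ∃ U : F →ₗᵢ[𝕜] F, g = U.toLinearMap ∘ₗ f := by
  obtain ⟨r, hr⟩ := f.rangeRestrict.exists_rightInverse_of_surjective
    (LinearMap.range_rangeRestrict f)
  have hfr (u : LinearMap.range f) : f (r u) = u := congr_arg Subtype.val (LinearMap.congr_fun hr u)
  let L : LinearMap.range f →ₗᵢ[𝕜] F :=
    ⟨g ∘ₗ r, fun u => by rw [LinearMap.comp_apply, ← h, hfr, Submodule.coe_norm]⟩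
  refine ⟨L.extend, LinearMap.ext fun v => ?_⟩
  have hker : g (r (f.rangeRestrict v) - v) = 0 := by
    rw [← norm_eq_zero, ← h, map_sub, hfr]
    exact norm_sub_eq_zero_iff.2 rfl
  rw [map_sub, sub_eq_zero] at hker
  exact hker.symm.trans (L.extend_apply (f.rangeRestrict v)).symm

lemma mul_conjTranspose_self_eq_iff {𝕜 m n : Type*} [RCLike 𝕜] [Finite m] [Fintype n]
    [DecidableEq n] {A B : Matrix m n 𝕜} :
    A * Aᴴ = B * Bᴴ ↔ ∃ U ∈ unitaryGroup n 𝕜, B = A * U := by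
  classical
  cases nonempty_fintype m
  constructor
  · intro h
    have hnorm (C : Matrix m n 𝕜) (v : EuclideanSpace 𝕜 m) :
        ((‖toEuclideanLin Cᴴ v‖ ^ 2 : ℝ) : 𝕜) = star v.ofLp ⬝ᵥ (C * Cᴴ) *ᵥ v.ofLp := by
      rw [RCLike.ofReal_pow, ← inner_self_eq_norm_sq_to_K (𝕜 := 𝕜),
        EuclideanSpace.inner_eq_star_dotProduct, dotProduct_comm, ← mulVec_mulVec,
        dotProduct_mulVec (star _)]
      simp [star_mulVec]
    obtain ⟨U, hU⟩ := exists_linearIsometry_comp_eq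
      (f := toEuclideanLin Aᴴ) (g := toEuclideanLin Bᴴ) fun v => by
        rw [← sq_eq_sq₀ (norm_nonneg _) (norm_nonneg _), ← RCLike.ofReal_inj (K := 𝕜), hnorm, hnorm,
          h]
    let V := (toEuclideanCLM (n := n) (𝕜 := 𝕜)).symm
      (Unitary.linearIsometryEquiv.symm (U.toLinearIsometryEquiv rfl)).1
    have hV : V ∈ unitaryGroup n 𝕜 := Unitary.map_mem _ (Subtype.prop _)
    have hVU (v : EuclideanSpace 𝕜 n) : toEuclideanLin V v = U v :=
      DFunLike.congr_fun ((toEuclideanCLM (n := n) (𝕜 := 𝕜)).apply_symm_apply _) v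
    have hBA : Bᴴ = V * Aᴴ := by
      refine toEuclideanLin.injective (LinearMap.ext fun v => ?_)
      rw [hU, toLpLin_mul_same]
      exact (hVU _).symm
    refine ⟨star V, Unitary.star_mem hV, ?_⟩
    rw [← conjTranspose_conjTranspose B, hBA, conjTranspose_mul, conjTranspose_conjTranspose,
      star_eq_conjTranspose]
  · rintro ⟨U, hU, rfl⟩
    rw [conjTranspose_mul, Matrix.mul_assoc, ← Matrix.mul_assoc U, ← star_eq_conjTranspose U,
      mem_unitaryGroup_iff.1 hU, Matrix.one_mul]

end Purification

section LocalUnitary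

open Matrix Kronecker

open scoped ComplexOrder

variable {n : ℕ} {S T : Fin n → Prop} [DecidablePred S] [DecidablePred T]

lemma merge_of_mem (a : Bits S) (c : Bits fun q => ¬ S q) {q : Fin n} (hq : S q) :
    merge S a c q = a ⟨q, hq⟩ :=
  dif_pos hq

lemma merge_of_not_mem (a : Bits S) (c : Bits fun q => ¬ S q) {q : Fin n} (hq : ¬ S q) :
    merge S a c q = c ⟨q, hq⟩ :=
  dif_neg hq

lemma restrict_merge (a : Bits S) (c : Bits fun q => ¬ S q) :
    (fun q : {q // S q} => merge S a c q) = a :=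
  funext fun q => merge_of_mem a c q.2

variable (S) in
/-- The matrix of `U ⊗ 1`, where `U` acts on the qubits in `S`. -/
def embedLocal : Matrix (Bits S) (Bits S) ℂ →* Matrix (Fin n → Bool) (Fin n → Bool) ℂ where
  toFun U := (U ⊗ₖ (1 : Matrix (Bits fun q => ¬ S q) (Bits fun q => ¬ S q) ℂ)).submatrix
    (Equiv.piEquivPiSubtypeProd S fun _ => Bool) (Equiv.piEquivPiSubtypeProd S fun _ => Bool)
  map_one' := by rw [one_kronecker_one, submatrix_one_equiv]
  map_mul' U U' := by rw [submatrix_mul_equiv, ← mul_kronecker_mul, one_mul]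

lemma star_embedLocal (U : Matrix (Bits S) (Bits S) ℂ) :
    star (embedLocal S U) = embedLocal S (star U) := by
  simp only [embedLocal, MonoidHom.coe_mk, OneHom.coe_mk, star_eq_conjTranspose,
    conjTranspose_submatrix, conjTranspose_kronecker, conjTranspose_one]

lemma embedLocal_apply (U : Matrix (Bits S) (Bits S) ℂ) (c d : Fin n → Bool) :
    embedLocal S U c d = if ∀ q, ¬ S q → c q = d q then U (fun q => c q) (fun q => d q) else 0 := by
  have hiff : ((fun q : {q // ¬ S q} => c q) = fun q : {q // ¬ S q} => d q) ↔
      ∀ q, ¬ S q → c q = d q := by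
    rw [funext_iff, Subtype.forall]
  simp [embedLocal, Equiv.piEquivPiSubtypeProd, one_apply, hiff]

lemma embedLocal_not (V : Matrix (Bits fun q => ¬ S q) (Bits fun q => ¬ S q) ℂ) :
    embedLocal (fun q => ¬ S q) V
      = ((1 : Matrix (Bits S) (Bits S) ℂ) ⊗ₖ V).submatrix
        (Equiv.piEquivPiSubtypeProd S fun _ => Bool)
        (Equiv.piEquivPiSubtypeProd S fun _ => Bool) := by
  ext c d
  have hiff : ((fun q : {q // S q} => c q) = fun q : {q // S q} => d q) ↔
      ∀ q, S q → c q = d q := by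
    rw [funext_iff, Subtype.forall]
  simp [embedLocal_apply, Equiv.piEquivPiSubtypeProd, one_apply, hiff]

lemma embedLocal_injective : Function.Injective (embedLocal S) := by
  intro U V h
  ext a b
  have := congr_fun₂ h (merge S a fun _ => false) (merge S b fun _ => false)
  rw [embedLocal_apply, embedLocal_apply, if_pos, if_pos] at this
  · simpa only [restrict_merge] using this
  all_goals
    intro q hq
    rw [merge_of_not_mem _ _ hq, merge_of_not_mem _ _ hq]

lemma range_embedLocal_mono (hST : ∀ q, S q → T q) :
    Set.range (embedLocal S) ⊆ Set.range (embedLocal T) := by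
  rintro _ ⟨U, rfl⟩
  refine ⟨of fun a b => embedLocal S U (merge T a fun _ => false) (merge T b fun _ => false), ?_⟩
  ext c d
  have hS (c : Fin n → Bool) : (fun q : {q // S q} =>
      merge T (fun q => c q) (fun _ => false) q) = fun q : {q // S q} => c q :=
    funext fun q => merge_of_mem _ _ (hST q q.2)
  have hiff : ((∀ q, ¬ T q → c q = d q) ∧ ∀ q, ¬ S q → merge T (fun q => c q) (fun _ => false) q
      = merge T (fun q => d q) (fun _ => false) q) ↔ ∀ q, ¬ S q → c q = d q := by
    refine ⟨fun h q hq => ?_, fun h => ⟨fun q hq => h q (mt (hST q) hq), fun q hq => ?_⟩⟩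
    · by_cases hT : T q
      · simpa only [merge_of_mem _ _ hT] using h.2 q hq
      · exact h.1 q hT
    · by_cases hT : T q
      · simpa only [merge_of_mem _ _ hT] using h q hq
      · simp only [merge_of_not_mem _ _ hT]
  rw [embedLocal_apply, of_apply, embedLocal_apply, embedLocal_apply, ← ite_and, hS, hS]
  exact if_congr hiff rfl rfl

lemma commute_embedLocal_not (U : Matrix (Bits S) (Bits S) ℂ)
    (V : Matrix (Bits fun q => ¬ S q) (Bits fun q => ¬ S q) ℂ) :
    Commute (embedLocal S U) (embedLocal (fun q => ¬ S q) V) := by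
  rw [embedLocal_not]
  simp only [Commute, SemiconjBy, embedLocal, MonoidHom.coe_mk, OneHom.coe_mk, submatrix_mul_equiv,
    ← mul_kronecker_mul, mul_one, one_mul]

variable (S) in
/-- The group of unitary transformations that act on the qubits in `S` only. -/
def localUnitary : Subgroup (unitaryGroup (Fin n → Bool) ℂ) where
  carrier := {W | (W : Matrix (Fin n → Bool) (Fin n → Bool) ℂ) ∈ Set.range (embedLocal S)}
  one_mem' := ⟨1, map_one _⟩
  mul_mem' := by
    rintro W W' ⟨U, hU⟩ ⟨U', hU'⟩
    exact ⟨U * U', by rw [map_mul, hU, hU', UnitaryGroup.mul_val]⟩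
  inv_mem' := by
    rintro W ⟨U, hU⟩
    exact ⟨star U, by rw [← star_embedLocal, hU, UnitaryGroup.inv_val]⟩

lemma localUnitary_mono (hST : ∀ q, S q → T q) : localUnitary S ≤ localUnitary T :=
  fun _ hW => range_embedLocal_mono hST hW

lemma embedLocal_mem_unitaryGroup_iff {U : Matrix (Bits S) (Bits S) ℂ} :
    embedLocal S U ∈ unitaryGroup (Fin n → Bool) ℂ ↔ U ∈ unitaryGroup (Bits S) ℂ := by
  rw [mem_unitaryGroup_iff, mem_unitaryGroup_iff, star_embedLocal, ← map_mul,
    ← map_one (embedLocal S), embedLocal_injective.eq_iff]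

lemma commute_of_mem_localUnitary (hST : ∀ q, T q → ¬ S q) {W V : unitaryGroup (Fin n → Bool) ℂ}
    (hW : W ∈ localUnitary S) (hV : V ∈ localUnitary T) : Commute W V := by
  obtain ⟨U, hU⟩ := hW
  obtain ⟨U', hU'⟩ := localUnitary_mono hST hV
  refine Subtype.ext ?_
  rw [UnitaryGroup.mul_val, UnitaryGroup.mul_val, ← hU, ← hU']
  exact commute_embedLocal_not U U'

lemma embedLocal_mulVec (U : Matrix (Bits S) (Bits S) ℂ) (ψ : (Fin n → Bool) → ℂ) :
    embedLocal S U *ᵥ ψ = applyLocal S U ψ := by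
  ext c
  rw [mulVec, dotProduct, applyLocal,
    ← (Equiv.piEquivPiSubtypeProd S fun _ => Bool).symm.sum_comp, Fintype.sum_prod_type]
  refine Finset.sum_congr rfl fun a _ => ?_
  change ∑ d, embedLocal S U c (merge S a d) * ψ (merge S a d) = _
  rw [Fintype.sum_eq_single fun q : {q // ¬ S q} => c q]
  · rw [embedLocal_apply, restrict_merge, if_pos]
    exact fun q hq => (merge_of_not_mem a (fun q => c q) hq).symm
  · intro d hd
    rw [embedLocal_apply, if_neg, zero_mul]
    exact fun h => hd (funext fun q => ((h q q.2).trans (merge_of_not_mem _ _ q.2)).symm)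

variable (S) in
/-- The coefficients of the state vector `ψ`, seen as a linear map from the qubits outside of `S` to
those in `S`. -/
def amplitudeMatrix (ψ : (Fin n → Bool) → ℂ) : Matrix (Bits S) (Bits fun q => ¬ S q) ℂ :=
  of fun a c => ψ (merge S a c)

lemma amplitudeMatrix_injective : Function.Injective (amplitudeMatrix S) := by
  intro ψ φ h
  ext c
  obtain ⟨⟨a, b⟩, rfl⟩ := (Equiv.piEquivPiSubtypeProd S fun _ => Bool).symm.surjective c
  exact congr_fun₂ h a b

lemma reducedState_eq_mul_conjTranspose (ψ : (Fin n → Bool) → ℂ) :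
    reducedState S ψ = amplitudeMatrix S ψ * (amplitudeMatrix S ψ)ᴴ := by
  ext a b
  simp [reducedState, amplitudeMatrix, mul_apply]

lemma amplitudeMatrix_embedLocal_not_mulVec
    (V : Matrix (Bits fun q => ¬ S q) (Bits fun q => ¬ S q) ℂ) (ψ : (Fin n → Bool) → ℂ) :
    amplitudeMatrix S (embedLocal (fun q => ¬ S q) V *ᵥ ψ) = amplitudeMatrix S ψ * Vᵀ := by
  ext a b
  rw [amplitudeMatrix, of_apply, mulVec, dotProduct, embedLocal_not,
    ← (Equiv.piEquivPiSubtypeProd S fun _ => Bool).symm.sum_comp, Fintype.sum_prod_type,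
    Fintype.sum_eq_single a fun a' ha => by simp [merge, one_apply, ha.symm]]
  simp [amplitudeMatrix, merge, mul_apply, mul_comm]

/-- All purifications of a mixed state are equivalent under unitary transformations of the purifying
system. -/
lemma reducedState_eq_iff {ψ φ : (Fin n → Bool) → ℂ} :
    reducedState S ψ = reducedState S φ ↔
      ∃ W ∈ localUnitary fun q => ¬ S q, φ = W.1 *ᵥ ψ := by
  rw [reducedState_eq_mul_conjTranspose, reducedState_eq_mul_conjTranspose,
    mul_conjTranspose_self_eq_iff]
  constructor
  · rintro ⟨U, hU, hφ⟩
    refine ⟨⟨embedLocal (fun q => ¬ S q) Uᵀ, embedLocal_mem_unitaryGroup_iff.2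
      (transpose_mem_unitaryGroup_iff.2 hU)⟩, ⟨_, rfl⟩, amplitudeMatrix_injective (S := S) ?_⟩
    rw [amplitudeMatrix_embedLocal_not_mulVec, transpose_transpose, hφ]
  · rintro ⟨W, ⟨V, hV⟩, rfl⟩
    rw [← hV, amplitudeMatrix_embedLocal_not_mulVec]
    refine ⟨Vᵀ, transpose_mem_unitaryGroup_iff.2 (embedLocal_mem_unitaryGroup_iff.1 ?_), rfl⟩
    exact hV ▸ W.2

lemma reducedState_mulVec (hST : ∀ q, T q → ¬ S q) {W : unitaryGroup (Fin n → Bool) ℂ}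
    (hW : W ∈ localUnitary T) (ψ : (Fin n → Bool) → ℂ) :
    reducedState S (W.1 *ᵥ ψ) = reducedState S ψ :=
  (reducedState_eq_iff.2 ⟨W, localUnitary_mono hST hW, rfl⟩).symm

lemma sum_ite_normSq_eq (ψ : (Fin n → Bool) → ℂ) (p : Bits S → Prop) [DecidablePred p] :
    ∑ c : Fin n → Bool, (if p fun q => c q then ‖ψ c‖ ^ 2 else 0)
      = ∑ a, if p a then (reducedState S ψ a a).re else 0 := by
  rw [← (Equiv.piEquivPiSubtypeProd S fun _ => Bool).symm.sum_comp, Fintype.sum_prod_type]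
  refine Finset.sum_congr rfl fun a _ => ?_
  change ∑ d, (if p fun q => merge S a d q then ‖ψ (merge S a d)‖ ^ 2 else 0) = _
  simp only [restrict_merge]
  split_ifs
  · simp [reducedState, Complex.mul_conj', ← Complex.ofReal_pow]
  · simp

lemma isDensityMatrix_reducedState {ψ : (Fin n → Bool) → ℂ} (hψ : ∑ c, ‖ψ c‖ ^ 2 = 1) :
    IsDensityMatrix (reducedState S ψ) where
  posSemidef := by
    rw [reducedState_eq_mul_conjTranspose]
    exact posSemidef_self_mul_conjTranspose _
  trace_eq_one := by
    rw [← (Equiv.piEquivPiSubtypeProd S fun _ => Bool).symm.sum_comp, Fintype.sum_prod_type] at hψ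
    rw [← Complex.ofReal_one, ← hψ]
    simp [trace, reducedState, merge, Complex.mul_conj']

lemma sum_normSq_mulVec {m : Type*} [Fintype m] [DecidableEq m] (W : unitaryGroup m ℂ)
    (ψ : m → ℂ) : ∑ c, ‖(W.1 *ᵥ ψ) c‖ ^ 2 = ∑ c, ‖ψ c‖ ^ 2 := by
  have hdot (v : m → ℂ) : ((∑ c, ‖v c‖ ^ 2 : ℝ) : ℂ) = star v ⬝ᵥ v := by
    simp [dotProduct, Complex.conj_mul']
  rw [← Complex.ofReal_inj, hdot, hdot, star_mulVec, ← dotProduct_mulVec, mulVec_mulVec,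
    ← star_eq_conjTranspose, Unitary.star_mul_self_of_mem W.2, one_mulVec]

end LocalUnitary

/-! # Protocols with privacy loss zero -/

section PrivacyLoss

open Matrix

lemma iSup₃_coe_eq_zero_iff {α β γ : Type*} [Nonempty α] [Nonempty β] [Nonempty γ]
    {F : α → β → γ → ℝ} (hF : ∀ a b c, 0 ≤ F a b c) :
    ⨆ (a) (b) (c), (F a b c : EReal) = 0 ↔ ∀ a b c, F a b c = 0 := by
  have hnonneg : 0 ≤ ⨆ (a) (b) (c), (F a b c : EReal) := by
    obtain ⟨⟨a⟩, ⟨b⟩, ⟨c⟩⟩ := And.intro ‹Nonempty α› (And.intro ‹Nonempty β› ‹Nonempty γ›)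
    exact le_iSup_of_le a (le_iSup_of_le b (le_iSup_of_le c (EReal.coe_nonneg.2 (hF a b c))))
  rw [← hnonneg.ge_iff_eq']
  simp only [iSup_le_iff, EReal.coe_nonpos, (hF _ _ _).ge_iff_eq']

lemma forall_stdSimplex_iff {I : Type*} [Fintype I] [Nonempty I] {p : I → I → Prop} :
    (∀ (μ : stdSimplex ℝ I) (i j), μ.1 i ≠ 0 → μ.1 j ≠ 0 → p i j) ↔ ∀ i j, p i j := by
  refine ⟨fun h i j => ?_, fun h μ i j _ _ => h i j⟩
  exact h stdSimplex.barycenter i j (by simp) (by simp)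

instance : Nonempty Player := ⟨Player.al⟩

lemma forall_player_iff {p : Player → Prop} : (∀ a, p a) ↔ p Player.al ∧ p Player.bob :=
  ⟨fun h => ⟨h _, h _⟩, fun h a => by cases a; exacts [h.1, h.2]⟩

variable {X Y Z α β : Type*}

/-- What Al sees (`v`) and what Bob sees (`w`) is determined by the player's own input and the value
of `f`. -/
structure IsPrivate (f : X → Y → Z) (v : X → Y → α) (w : X → Y → β) : Prop where
  al : ∀ x y y', f x y = f x y' → v x y = v x y'
  bob : ∀ x x' y, f x y = f x' y → w x y = w x' y

/-- The two conditions on the left are what vanishing of the information divulged to Al and to Bob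
amounts to. -/
lemma forall_stdSimplex_iff_isPrivate [Fintype X] [Fintype Y] [Nonempty X] [Nonempty Y]
    {f : X → Y → Z} {v : X → Y → α} {w : X → Y → β} :
    ((∀ (μ : stdSimplex ℝ (X × Y)) (x y y'), f x y = f x y' → μ.1 (x, y) ≠ 0 → μ.1 (x, y') ≠ 0 →
        v x y = v x y') ∧
      ∀ (μ : stdSimplex ℝ (X × Y)) (y x x'), f x y = f x' y → μ.1 (x, y) ≠ 0 → μ.1 (x', y) ≠ 0 →
        w x y = w x' y) ↔ IsPrivate f v w := by
  have hal := forall_stdSimplex_iff (p := fun i j : X × Y =>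
    i.1 = j.1 → f i.1 i.2 = f j.1 j.2 → v i.1 i.2 = v j.1 j.2)
  have hbob := forall_stdSimplex_iff (p := fun i j : X × Y =>
    i.2 = j.2 → f i.1 i.2 = f j.1 j.2 → w i.1 i.2 = w j.1 j.2)
  constructor
  · rintro ⟨h₁, h₂⟩
    refine ⟨fun x y y' h => hal.1 ?_ (x, y) (x, y') rfl h,
      fun x x' y h => hbob.1 ?_ (x, y) (x', y) rfl h⟩
    · rintro μ ⟨x, y⟩ ⟨_, y'⟩ hy hy' rfl h
      exact h₁ μ x y y' h hy hy'
    · rintro μ ⟨x, y⟩ ⟨x', _⟩ hx hx' rfl h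
      exact h₂ μ y x x' h hx hx'
  · exact fun h => ⟨fun _ x y y' hf _ _ => h.al x y y' hf, fun _ y x x' hf _ _ => h.bob x x' y hf⟩

namespace QuantumProtocol

variable (P : QuantumProtocol X Y Z)

/-- The mixed state of the qubits that player `p` owns when `t` rounds have been played. -/
def localState (p : Player) (t : ℕ) (x : X) (y : Y) :
    Matrix (Bits fun q => P.owner t q = p) (Bits fun q => P.owner t q = p) ℂ :=
  reducedState _ (P.state x y t)

variable {P}

lemma exists_state_succ_of_al {t : ℕ} (h : P.speaker t = Player.al) :
    ∃ U : X → unitaryGroup (Fin P.qubits → Bool) ℂ,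
      (∀ x, U x ∈ localUnitary fun q => P.owner t q = Player.al) ∧
        ∀ x y, P.state x y (t + 1) = (U x).1 *ᵥ P.state x y t :=
  ⟨fun x => ⟨embedLocal _ (P.opAl t x).1, embedLocal_mem_unitaryGroup_iff.2 (P.opAl t x).2⟩,
    fun _ => ⟨_, rfl⟩, fun x y => by rw [embedLocal_mulVec, state, h]⟩

lemma exists_state_succ_of_bob {t : ℕ} (h : P.speaker t = Player.bob) :
    ∃ U : Y → unitaryGroup (Fin P.qubits → Bool) ℂ,
      (∀ y, U y ∈ localUnitary fun q => P.owner t q = Player.bob) ∧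
        ∀ x y, P.state x y (t + 1) = (U y).1 *ᵥ P.state x y t :=
  ⟨fun y => ⟨embedLocal _ (P.opBob t y).1, embedLocal_mem_unitaryGroup_iff.2 (P.opBob t y).2⟩,
    fun _ => ⟨_, rfl⟩, fun x y => by rw [embedLocal_mulVec, state, h]⟩

lemma sum_normSq_state (x : X) (y : Y) (t : ℕ) : ∑ c, ‖P.state x y t c‖ ^ 2 = 1 := by
  induction t with
  | zero =>
    rw [Fintype.sum_eq_single fun _ => false]
    · simp [state]
    · intro c hc
      simp [state, hc]
  | succ t ih =>
    cases h : P.speaker t with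
    | al =>
      obtain ⟨U, -, hU⟩ := exists_state_succ_of_al h
      rw [hU, sum_normSq_mulVec, ih]
    | bob =>
      obtain ⟨U, -, hU⟩ := exists_state_succ_of_bob h
      rw [hU, sum_normSq_mulVec, ih]

lemma isDensityMatrix_localState (p : Player) (t : ℕ) (x : X) (y : Y) :
    IsDensityMatrix (P.localState p t x y) :=
  isDensityMatrix_reducedState (sum_normSq_state x y t)

variable [Fintype X] [Fintype Y] {f : X → Y → Z}

lemma divulged_al (t : ℕ) (μ : X × Y → ℝ) : P.divulged f t Player.al μ =
    quantumDivulged (fun y x => f x y) (fun y x => P.localState Player.al t x y)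
      fun y x => μ (x, y) := rfl

lemma divulged_bob (t : ℕ) (μ : X × Y → ℝ) : P.divulged f t Player.bob μ =
    quantumDivulged f (P.localState Player.bob t) fun x y => μ (x, y) := rfl

lemma divulged_nonneg (t : ℕ) (p : Player) (μ : stdSimplex ℝ (X × Y)) :
    0 ≤ P.divulged f t p μ.1 := by
  cases p
  · rw [divulged_al]
    exact quantumDivulged_nonneg (fun y x => isDensityMatrix_localState _ t x y) fun _ _ => μ.2.1 _
  · rw [divulged_bob]
    exact quantumDivulged_nonneg (fun x y => isDensityMatrix_localState _ t x y) fun _ _ => μ.2.1 _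

lemma privacyLoss_eq_zero_iff [Nonempty X] [Nonempty Y] : P.privacyLoss f = 0 ↔
    ∀ t ≤ P.rounds, IsPrivate f (P.localState Player.al t) (P.localState Player.bob t) := by
  refine (iSup₃_coe_eq_zero_iff (F := fun (t : Fin (P.rounds + 1)) p (μ : stdSimplex ℝ (X × Y)) =>
    P.divulged f t p μ.1) fun t => divulged_nonneg t.1).trans ?_
  simp only [Fin.forall_iff, Nat.lt_succ_iff]
  refine forall₂_congr fun t _ => ?_
  rw [forall_player_iff, ← forall_stdSimplex_iff_isPrivate]
  refine and_congr (forall_congr' fun μ => ?_) (forall_congr' fun μ => ?_)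
  · rw [divulged_al]
    exact quantumDivulged_eq_zero_iff (fun y x => isDensityMatrix_localState _ t x y)
      fun _ _ => μ.2.1 _
  · rw [divulged_bob]
    exact quantumDivulged_eq_zero_iff (fun x y => isDensityMatrix_localState _ t x y)
      fun _ _ => μ.2.1 _

end QuantumProtocol

namespace ClassicalProtocol

variable (P : ClassicalProtocol X Y Z)

/-- The joint distribution of the coins of both players. -/
noncomputable def coinProb (c : Fin P.coinsAl × Fin P.coinsBob) : ℝ :=
  P.distAl.1 c.1 * P.distBob.1 c.2

/-- The distribution of Al's coins and the messages of the first `t` rounds. -/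
noncomputable def viewAl (t : ℕ) (x : X) (y : Y) : Fin P.coinsAl × List (List Bool) → ℝ :=
  massAt P.coinProb fun c => (c.1, P.transcript x y c.1 c.2 t)

/-- The distribution of Bob's coins and the messages of the first `t` rounds. -/
noncomputable def viewBob (t : ℕ) (x : X) (y : Y) : Fin P.coinsBob × List (List Bool) → ℝ :=
  massAt P.coinProb fun c => (c.2, P.transcript x y c.1 c.2 t)

lemma coinProb_mem_stdSimplex : P.coinProb ∈ stdSimplex ℝ (Fin P.coinsAl × Fin P.coinsBob) := by
  refine ⟨fun c => mul_nonneg (P.distAl.2.1 _) (P.distBob.2.1 _), ?_⟩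
  simp only [coinProb, Fintype.sum_prod_type, ← Finset.mul_sum, P.distBob.2.2, mul_one,
    P.distAl.2.2]

variable {P} [Fintype X] [Fintype Y] {f : X → Y → Z}

lemma divulged_al (t : ℕ) (μ : X × Y → ℝ) : P.divulged f t Player.al μ =
    condMutualInfo (fun ω : (X × Y) × _ => μ ω.1 * P.coinProb ω.2)
      (fun ω => (ω.2.1, P.transcript ω.1.1 ω.1.2 ω.2.1 ω.2.2 t)) (fun ω => ω.1.2)
      fun ω => (ω.1.1, f ω.1.1 ω.1.2) := rfl

lemma divulged_bob (t : ℕ) (μ : X × Y → ℝ) : P.divulged f t Player.bob μ =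
    condMutualInfo (fun ω : (X × Y) × _ => μ ω.1 * P.coinProb ω.2)
      (fun ω => (ω.2.2, P.transcript ω.1.1 ω.1.2 ω.2.1 ω.2.2 t)) (fun ω => ω.1.1)
      fun ω => (ω.1.2, f ω.1.1 ω.1.2) := rfl

lemma divulged_nonneg (t : ℕ) (p : Player) (μ : stdSimplex ℝ (X × Y)) :
    0 ≤ P.divulged f t p μ.1 := by
  cases p
  · rw [divulged_al]
    exact condMutualInfo_nonneg (g := fun y x => f x y) (Equiv.prodComm X Y) μ.2.1
      P.coinProb_mem_stdSimplex _
  · rw [divulged_bob]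
    exact condMutualInfo_nonneg (g := f) (Equiv.refl _) μ.2.1 P.coinProb_mem_stdSimplex _

lemma privacyLoss_eq_zero_iff [Nonempty X] [Nonempty Y] :
    P.privacyLoss f = 0 ↔ ∀ t ≤ P.rounds, IsPrivate f (P.viewAl t) (P.viewBob t) := by
  refine (iSup₃_coe_eq_zero_iff (F := fun (t : Fin (P.rounds + 1)) p (μ : stdSimplex ℝ (X × Y)) =>
    P.divulged f t p μ.1) fun t => divulged_nonneg t.1).trans ?_
  simp only [Fin.forall_iff, Nat.lt_succ_iff]
  refine forall₂_congr fun t _ => ?_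
  rw [forall_player_iff, ← forall_stdSimplex_iff_isPrivate]
  refine and_congr (forall_congr' fun μ => ?_) (forall_congr' fun μ => ?_)
  · rw [divulged_al]
    exact condMutualInfo_eq_zero_iff (g := fun y x => f x y) (Equiv.prodComm X Y) μ.2.1
      P.coinProb_mem_stdSimplex _
  · rw [divulged_bob]
    exact condMutualInfo_eq_zero_iff (g := f) (Equiv.refl _) μ.2.1 P.coinProb_mem_stdSimplex _

end ClassicalProtocol

end PrivacyLoss

/-! # Quantum protocols on forbidden submatrices -/

section MonochromaticMatrix

variable {R C Z : Type*} {M : Matrix R C Z}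

lemma isMonochromatic_of_row_const (hrow : ∀ x x', Relation.TransGen (RowRel M) x x')
    (h : ∀ x y y', M x y = M x y') : IsMonochromatic M := by
  intro x x' y y'
  induction hrow x x' with
  | single hr =>
    obtain ⟨y₁, hy⟩ := hr
    rw [h _ y y₁, hy, h _ y₁ y']
  | tail _ hr ih =>
    obtain ⟨y₁, hy⟩ := hr
    rw [ih, h _ y' y₁, hy, h _ y₁ y']

lemma isMonochromatic_of_col_const (hcol : ∀ y y', Relation.TransGen (ColRel M) y y')
    (h : ∀ x x' y, M x y = M x' y) : IsMonochromatic M :=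
  fun x x' y y' => isMonochromatic_of_row_const (M := M.transpose) hcol (fun y x x' => h x x' y)
    y y' x x'

lemma IsForbidden.nonempty (h : IsForbidden M) : Nonempty R ∧ Nonempty C := by
  obtain ⟨-, -, hM⟩ := h
  simp only [IsMonochromatic, not_forall] at hM
  obtain ⟨x, -, y, -⟩ := hM
  exact ⟨⟨x⟩, ⟨y⟩⟩

end MonochromaticMatrix

section QuantumLowerBound

open Matrix

variable {n : ℕ} {S T S' T' : Fin n → Prop} [DecidablePred S] [DecidablePred T] [DecidablePred S']
  [DecidablePred T'] {X Y Z : Type*} {ψ : X → Y → (Fin n → Bool) → ℂ}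

variable (S T ψ) in
/-- The states `ψ x y` arise from a single state when unitary transformations that depend on `x`
only act on the qubits in `S`, and unitary transformations that depend on `y` only act on those in
`T`. -/
def IsLocallyRelated : Prop :=
  ∃ (φ : (Fin n → Bool) → ℂ) (a : X → unitaryGroup (Fin n → Bool) ℂ)
    (b : Y → unitaryGroup (Fin n → Bool) ℂ), (∀ x, a x ∈ localUnitary S) ∧
      (∀ y, b y ∈ localUnitary T) ∧ ∀ x y, ψ x y = (a x * b y).1 *ᵥ φ

namespace IsLocallyRelated

lemma const (φ : (Fin n → Bool) → ℂ) : IsLocallyRelated S T fun (_ : X) (_ : Y) => φ :=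
  ⟨φ, 1, 1, fun _ => one_mem _, fun _ => one_mem _, fun _ _ => by simp⟩

lemma swap (hST : ∀ q, T q → ¬ S q) (h : IsLocallyRelated S T ψ) :
    IsLocallyRelated T S fun y x => ψ x y := by
  obtain ⟨φ, a, b, ha, hb, hψ⟩ := h
  refine ⟨φ, b, a, hb, ha, fun y x => ?_⟩
  simp only [hψ, (commute_of_mem_localUnitary hST (ha x) (hb y)).eq]

lemma mulVec (h : IsLocallyRelated S T ψ) {U : X → unitaryGroup (Fin n → Bool) ℂ}
    (hU : ∀ x, U x ∈ localUnitary S) : IsLocallyRelated S T fun x y => (U x).1 *ᵥ ψ x y := by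
  obtain ⟨φ, a, b, ha, hb, hψ⟩ := h
  refine ⟨φ, U * a, b, fun x => mul_mem (hU x) (ha x), hb, fun x y => ?_⟩
  simp only [hψ, mulVec_mulVec, Pi.mul_apply, mul_assoc, UnitaryGroup.mul_val]

lemma reducedState_eq (hST : ∀ q, T q → ¬ S q) (h : IsLocallyRelated S T ψ) (x x' : X) (y : Y) :
    reducedState T (ψ x y) = reducedState T (ψ x' y) := by
  obtain ⟨φ, a, b, ha, -, hψ⟩ := h
  have hTS : ∀ q, S q → ¬ T q := fun q hS hT => hST q hT hS
  rw [hψ, hψ, UnitaryGroup.mul_val, ← mulVec_mulVec, reducedState_mulVec hTS (ha x),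
    UnitaryGroup.mul_val, ← mulVec_mulVec, reducedState_mulVec hTS (ha x')]

/-- Qubits move from `S` to `T` without spoiling the relation, provided that the new holder cannot
tell enough of the inputs `x` apart: two purifications of his state differ by a unitary
transformation of the qubits that stay in `S'`. -/
lemma of_transGen (hST : ∀ q, T q → ¬ S q) (hS : ∀ q, S' q → S q) (hT : ∀ q, T q → T' q)
    (hST' : ∀ q, ¬ T' q → S' q) (h : IsLocallyRelated S T ψ) {r : X → X → Prop}
    (hr : ∀ x x', r x x' → ∃ y, reducedState T' (ψ x y) = reducedState T' (ψ x' y))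
    (hall : ∀ x x', Relation.TransGen r x x') : IsLocallyRelated S' T' ψ := by
  obtain ⟨φ, a, b, ha, hb, hψ⟩ := h
  have hcomm {W : unitaryGroup (Fin n → Bool) ℂ} (hW : W ∈ localUnitary S) (y : Y) :
      Commute W (b y) := commute_of_mem_localUnitary hST hW (hb y)
  have hlink (x x' : X) (h : r x x') :
      ∃ W ∈ localUnitary S', (a x').1 *ᵥ φ = W.1 *ᵥ (a x).1 *ᵥ φ := by
    obtain ⟨y, hy⟩ := hr x x' h
    obtain ⟨W, hW, hψW⟩ := reducedState_eq_iff.1 hy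
    replace hW : W ∈ localUnitary S' := localUnitary_mono hST' hW
    refine ⟨W, hW, mulVec_injective_of_isUnit (Unitary.isUnit_coe (U := b y)) ?_⟩
    simpa only [hψ, mulVec_mulVec, ← UnitaryGroup.mul_val, (hcomm (ha _) y).eq, ← mul_assoc,
      (hcomm (localUnitary_mono hS hW) y).eq] using hψW
  obtain hX | ⟨⟨x₀⟩⟩ := isEmpty_or_nonempty X
  · exact ⟨φ, a, 1, isEmptyElim, fun _ => one_mem _, isEmptyElim⟩
  have hbase (x : X) : ∃ W ∈ localUnitary S', (a x).1 *ᵥ φ = W.1 *ᵥ (a x₀).1 *ᵥ φ := by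
    induction hall x₀ x with
    | single h => exact hlink _ _ h
    | tail _ h ih =>
      obtain ⟨W, hW, hWφ⟩ := ih
      obtain ⟨V, hV, hVφ⟩ := hlink _ _ h
      exact ⟨V * W, mul_mem hV hW, by rw [hVφ, hWφ, mulVec_mulVec, ← UnitaryGroup.mul_val]⟩
  choose w hw hwφ using hbase
  refine ⟨(a x₀).1 *ᵥ φ, w, b, hw, fun y => localUnitary_mono hT (hb y), fun x y => ?_⟩
  rw [hψ, (hcomm (ha x) y).eq, UnitaryGroup.mul_val, ← mulVec_mulVec, hwφ, mulVec_mulVec,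
    ← UnitaryGroup.mul_val, (hcomm (localUnitary_mono hS (hw x)) y).eq]

end IsLocallyRelated

lemma player_ne_iff_eq {p p' a : Player} (h : p ≠ p') : a ≠ p' ↔ a = p := by
  cases p <;> cases p' <;> cases a <;> simp at h ⊢

namespace QuantumProtocol

variable {R C : Type*} {P : QuantumProtocol X Y Z} {f : X → Y → Z}

lemma isLocallyRelated_succ {t : ℕ} {p p' : Player} (hpp' : p ≠ p') (hp : P.speaker t = p)
    {U : R → unitaryGroup (Fin P.qubits → Bool) ℂ}
    (hU : ∀ x, U x ∈ localUnitary fun q => P.owner t q = p)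
    {σ σ' : R → C → (Fin P.qubits → Bool) → ℂ} (hσ' : ∀ x y, σ' x y = (U x).1 *ᵥ σ x y)
    (h : IsLocallyRelated (fun q => P.owner t q = p) (fun q => P.owner t q = p') σ)
    {r : R → R → Prop} (hr : ∀ x x', r x x' → ∃ y,
      reducedState (fun q => P.owner (t + 1) q = p') (σ' x y)
        = reducedState (fun q => P.owner (t + 1) q = p') (σ' x' y))
    (hall : ∀ x x', Relation.TransGen r x x') :
    IsLocallyRelated (fun q => P.owner (t + 1) q = p) (fun q => P.owner (t + 1) q = p') σ' := by
  obtain rfl : σ' = fun x y => (U x).1 *ᵥ σ x y := funext₂ hσ'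
  have hp' (q) (hq : P.owner t q = p') : P.owner (t + 1) q = p' := by
    rw [P.owner_succ t q (by rw [hq, hp]; exact hpp'.symm), hq]
  refine (h.mulVec hU).of_transGen ?_ ?_ hp'
    (fun q => (player_ne_iff_eq hpp').1) hr hall
  · rintro q rfl
    exact hpp'.symm
  · intro q hq
    rw [← player_ne_iff_eq hpp'] at hq ⊢
    exact mt (hp' q) hq

lemma isLocallyRelated_state
    (h : ∀ t ≤ P.rounds, IsPrivate f (P.localState Player.al t) (P.localState Player.bob t))
    {i : R → X} {j : C → Y}
    (hrow : ∀ x x', Relation.TransGen (RowRel ((Matrix.of f).submatrix i j)) x x')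
    (hcol : ∀ y y', Relation.TransGen (ColRel ((Matrix.of f).submatrix i j)) y y') {t : ℕ}
    (ht : t ≤ P.rounds) :
    IsLocallyRelated (fun q => P.owner t q = Player.al) (fun q => P.owner t q = Player.bob)
      fun x y => P.state (i x) (j y) t := by
  induction t with
  | zero => exact IsLocallyRelated.const _
  | succ t ih =>
    replace ih := ih (by omega)
    cases hp : P.speaker t with
    | al =>
      obtain ⟨U, hU, hstate⟩ := exists_state_succ_of_al hp
      refine isLocallyRelated_succ (by simp) hp (fun x => hU (i x)) (fun x y => hstate (i x) (j y))
        ih ?_ hrow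
      rintro x x' ⟨y, hy⟩
      exact ⟨y, (h _ ht).bob _ _ _ hy⟩
    | bob =>
      obtain ⟨U, hU, hstate⟩ := exists_state_succ_of_bob hp
      refine (isLocallyRelated_succ (by simp) hp (fun y => hU (j y))
        (fun y x => hstate (i x) (j y)) (ih.swap (by simp +contextual)) ?_ hcol).swap
        (by simp +contextual)
      rintro y y' ⟨x, hx⟩
      exact ⟨x, (h _ ht).al _ _ _ hx⟩

open Classical in
lemma resultProb_al (x : X) (y : Y) (z : Z) : P.resultProb Player.al x y z =
    ∑ a, if P.outAl x a = z then (P.localState Player.al P.rounds x y a a).re else 0 :=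
  sum_ite_normSq_eq (P.state x y P.rounds) fun a => P.outAl x a = z

open Classical in
lemma resultProb_bob (x : X) (y : Y) (z : Z) : P.resultProb Player.bob x y z =
    ∑ a, if P.outBob y a = z then (P.localState Player.bob P.rounds x y a a).re else 0 :=
  sum_ite_normSq_eq (P.state x y P.rounds) fun a => P.outBob y a = z

lemma resultProb_add_le (p : Player) (x : X) (y : Y) {z z' : Z} (hz : z ≠ z') :
    P.resultProb p x y z + P.resultProb p x y z' ≤ 1 := by
  rw [← sum_normSq_state (P := P) x y P.rounds, resultProb, resultProb, ← Finset.sum_add_distrib]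
  refine Finset.sum_le_sum fun c _ => ?_
  split_ifs with h h'
  · exact absurd (h.symm.trans h') hz
  all_goals simp

lemma Computes.eq_of_resultProb_eq {p : Player} {ε : ℝ} (h : P.Computes p f ε) (hε : ε < 1 / 2)
    {x x' : X} {y y' : Y} (heq : ∀ z, P.resultProb p x y z = P.resultProb p x' y' z) :
    f x y = f x' y' := by
  by_contra hne
  have hxy := h x y
  rw [heq] at hxy
  linarith [h x' y', resultProb_add_le (P := P) p x' y' hne]

theorem not_computes_of_containsForbidden [Fintype X] [Fintype Y] {f : X → Y → Z}
    (hf : ContainsForbidden f) {P : QuantumProtocol X Y Z} (hloss : P.privacyLoss f = 0)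
    {p : Player} {ε : ℝ} (hε : ε < 1 / 2) : ¬ P.Computes p f ε := by
  intro hP
  obtain ⟨A, B, hM⟩ := hf
  obtain ⟨⟨x₀⟩, ⟨y₀⟩⟩ := hM.nonempty
  have : Nonempty X := ⟨x₀⟩
  have : Nonempty Y := ⟨y₀⟩
  obtain ⟨hrow, hcol, hmono⟩ := hM
  have hrel := isLocallyRelated_state
    (privacyLoss_eq_zero_iff.1 hloss) hrow hcol le_rfl
  cases p with
  | al =>
    refine hmono (isMonochromatic_of_row_const hrow fun x y y' =>
      hP.eq_of_resultProb_eq hε fun z => ?_)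
    have hlocal : P.localState Player.al P.rounds x y = P.localState Player.al P.rounds x y' :=
      (hrel.swap (by simp +contextual)).reducedState_eq (by simp +contextual) y y' x
    rw [resultProb_al, resultProb_al, hlocal]
  | bob =>
    refine hmono (isMonochromatic_of_col_const hcol fun x x' y =>
      hP.eq_of_resultProb_eq hε fun z => ?_)
    have hlocal : P.localState Player.bob P.rounds x y = P.localState Player.bob P.rounds x' y :=
      hrel.reducedState_eq (by simp +contextual) x x' y
    rw [resultProb_bob, resultProb_bob, hlocal]

end QuantumProtocol

end QuantumLowerBound

/-! # Classical protocols on forbidden submatrices -/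

section ClassicalLowerBound

section Compatibility

variable {Ω Ω' : Type*}

/-- Whether `m` can be the transcript of the first `t` rounds, as far as a player can tell who
speaks in the rounds `t` with `speaks t` and then sends the message `msg t m'` after the
transcript `m'`. -/
def IsCompatible (speaks : ℕ → Prop) (msg : ℕ → List (List Bool) → List Bool) :
    ℕ → List (List Bool) → Prop
  | 0, m => m = []
  | t + 1, m => ∃ m' w, m = m' ++ [w] ∧ IsCompatible speaks msg t m' ∧ (speaks t → w = msg t m')

open Classical in
/-- The probability that the transcript `m` of the first `t` rounds is compatible with the messages
`msg ω` of a player whose coins `ω` have the probabilities `pr ω`. -/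
noncomputable def compatProb [Fintype Ω] (pr : Ω → ℝ) (speaks : ℕ → Prop)
    (msg : Ω → ℕ → List (List Bool) → List Bool) (t : ℕ) (m : List (List Bool)) : ℝ :=
  ∑ ω, if IsCompatible speaks (msg ω) t m then pr ω else 0

variable {speaks speaks' : ℕ → Prop} {t : ℕ}

lemma not_isCompatible_succ_nil {msg : ℕ → List (List Bool) → List Bool} :
    ¬ IsCompatible speaks msg (t + 1) [] := by
  rintro ⟨m', w, h, -⟩
  simp at h

lemma isCompatible_succ_append {msg : ℕ → List (List Bool) → List Bool} {m : List (List Bool)}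
    {w : List Bool} : IsCompatible speaks msg (t + 1) (m ++ [w]) ↔
      IsCompatible speaks msg t m ∧ (speaks t → w = msg t m) := by
  refine ⟨?_, fun h => ⟨m, w, rfl, h⟩⟩
  rintro ⟨m', w', h, hm⟩
  obtain ⟨rfl, hw⟩ := List.append_inj' h rfl
  obtain rfl : w = w' := by simpa using hw
  exact hm

variable [Fintype Ω] [Fintype Ω'] {pr : Ω → ℝ} {pr' : Ω' → ℝ}

open Classical in
lemma ite_le_compatProb (hpr : ∀ ω, 0 ≤ pr ω) {msg : Ω → ℕ → List (List Bool) → List Bool} (ω : Ω)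
    (m : List (List Bool)) :
    (if IsCompatible speaks (msg ω) t m then pr ω else 0) ≤ compatProb pr speaks msg t m :=
  Finset.single_le_sum (f := fun ω => if IsCompatible speaks (msg ω) t m then pr ω else 0)
    (fun ω _ => ite_nonneg (hpr ω) le_rfl) (Finset.mem_univ ω)

lemma compatProb_nonneg (hpr : ∀ ω, 0 ≤ pr ω) {msg : Ω → ℕ → List (List Bool) → List Bool}
    (m : List (List Bool)) : 0 ≤ compatProb pr speaks msg t m :=
  Finset.sum_nonneg fun ω _ => by classical exact ite_nonneg (hpr ω) le_rfl

lemma compatProb_succ_nil {msg : Ω → ℕ → List (List Bool) → List Bool} :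
    compatProb pr speaks msg (t + 1) [] = 0 :=
  Finset.sum_eq_zero fun _ _ => if_neg not_isCompatible_succ_nil

lemma compatProb_succ_append_le (hpr : ∀ ω, 0 ≤ pr ω)
    {msg : Ω → ℕ → List (List Bool) → List Bool} (m : List (List Bool)) (w : List Bool) :
    compatProb pr speaks msg (t + 1) (m ++ [w]) ≤ compatProb pr speaks msg t m := by
  refine Finset.sum_le_sum fun ω _ => ?_
  rw [isCompatible_succ_append]
  split_ifs with h h'
  · rfl
  · exact absurd h.1 h'
  · exact hpr ω
  · rfl

lemma compatProb_succ_append_of_not (ht : ¬ speaks t)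
    {msg : Ω → ℕ → List (List Bool) → List Bool} (m : List (List Bool)) (w : List Bool) :
    compatProb pr speaks msg (t + 1) (m ++ [w]) = compatProb pr speaks msg t m := by
  have hiff (ω) : IsCompatible speaks (msg ω) (t + 1) (m ++ [w]) ↔
      IsCompatible speaks (msg ω) t m := by simp [isCompatible_succ_append, ht]
  exact Finset.sum_congr rfl fun ω _ => by classical exact if_congr (hiff ω) rfl rfl

lemma mul_eq_mul_of_le {a a' b b' : ℝ} (h0 : 0 ≤ a') (hle : a' ≤ a) (h : a * b = a * b') :
    a' * b = a' * b' := by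
  rcases mul_eq_mul_left_iff.1 h with h | h
  · rw [h]
  · rw [le_antisymm (h ▸ hle) h0, zero_mul, zero_mul]

lemma compatProb_mul_succ (hpr : ∀ ω, 0 ≤ pr ω) (ht : ¬ speaks' t)
    {msg : Ω → ℕ → List (List Bool) → List Bool} {msg₁ msg₂ : Ω' → ℕ → List (List Bool) → List Bool}
    (h : ∀ m, compatProb pr speaks msg t m * compatProb pr' speaks' msg₁ t m
      = compatProb pr speaks msg t m * compatProb pr' speaks' msg₂ t m) (m : List (List Bool)) :
    compatProb pr speaks msg (t + 1) m * compatProb pr' speaks' msg₁ (t + 1) m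
      = compatProb pr speaks msg (t + 1) m * compatProb pr' speaks' msg₂ (t + 1) m := by
  obtain rfl | ⟨m, w, rfl⟩ := m.eq_nil_or_concat'
  · rw [compatProb_succ_nil, zero_mul, zero_mul]
  · rw [compatProb_succ_append_of_not ht, compatProb_succ_append_of_not ht]
    exact mul_eq_mul_of_le (compatProb_nonneg hpr _) (compatProb_succ_append_le hpr m w) (h m)

end Compatibility

open Classical in
lemma massAt_comp_congr {Ω α β : Type*} [Fintype Ω] {pr : Ω → ℝ} {V W : Ω → α}
    (h : massAt pr V = massAt pr W) (e : α → β) :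
    massAt pr (fun ω => e (V ω)) = massAt pr fun ω => e (W ω) := by
  let s := Finset.univ.image V ∪ Finset.univ.image W
  have key {U : Ω → α} (hU : ∀ ω, U ω ∈ s) (b : β) :
      massAt pr (fun ω => e (U ω)) b = ∑ a ∈ s, if e a = b then massAt pr U a else 0 := by
    simp only [massAt, ← Finset.sum_filter (fun a => e a = b)]
    rw [Finset.sum_comm]
    refine Finset.sum_congr rfl fun ω _ => ?_
    simp [hU ω]
  funext b
  rw [key (by simp [s]), key (by simp [s]), h]

namespace ClassicalProtocol

variable {X Y Z : Type*} (P : ClassicalProtocol X Y Z)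

/-- `IsCompatible` for Al with input `x` and coins `r`. -/
def CompatAl (t : ℕ) (x : X) (r : Fin P.coinsAl) : List (List Bool) → Prop :=
  IsCompatible (fun t => P.speaker t = Player.al) (fun t => P.msgAl t x r) t

/-- `IsCompatible` for Bob with input `y` and coins `s`. -/
def CompatBob (t : ℕ) (y : Y) (s : Fin P.coinsBob) : List (List Bool) → Prop :=
  IsCompatible (fun t => P.speaker t = Player.bob) (fun t => P.msgBob t y s) t

/-- `compatProb` for Al with input `x`. -/
noncomputable def compatProbAl (t : ℕ) (x : X) : List (List Bool) → ℝ :=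
  compatProb P.distAl.1 (fun t => P.speaker t = Player.al) (fun r t => P.msgAl t x r) t

/-- `compatProb` for Bob with input `y`. -/
noncomputable def compatProbBob (t : ℕ) (y : Y) : List (List Bool) → ℝ :=
  compatProb P.distBob.1 (fun t => P.speaker t = Player.bob) (fun s t => P.msgBob t y s) t

/-- The distribution of the messages of the first `t` rounds. -/
noncomputable def transcriptProb (t : ℕ) (x : X) (y : Y) : List (List Bool) → ℝ :=
  massAt P.coinProb fun c => P.transcript x y c.1 c.2 t

variable {P}

lemma transcript_eq_iff {x : X} {y : Y} {r : Fin P.coinsAl} {s : Fin P.coinsBob} {t : ℕ}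
    {m : List (List Bool)} :
    P.transcript x y r s t = m ↔ P.CompatAl t x r m ∧ P.CompatBob t y s m := by
  induction t generalizing m with
  | zero => simp [transcript, CompatAl, CompatBob, IsCompatible, eq_comm]
  | succ t ih =>
    obtain rfl | ⟨m, w, rfl⟩ := m.eq_nil_or_concat'
    · simp [transcript, CompatAl, not_isCompatible_succ_nil]
    · simp only [CompatAl, CompatBob] at ih ⊢
      rw [isCompatible_succ_append, isCompatible_succ_append, and_and_and_comm, ← ih, transcript,
        List.append_singleton_inj]
      refine and_congr_right ?_
      rintro rfl
      cases hs : P.speaker t <;> simp [eq_comm]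

open Classical in
/-- For given inputs and a given transcript, the compatible pairs of coins form a rectangle. -/
lemma viewAl_apply (t : ℕ) (x : X) (y : Y) (r : Fin P.coinsAl) (m : List (List Bool)) :
    P.viewAl t x y (r, m) =
      (if P.CompatAl t x r m then P.distAl.1 r else 0) * P.compatProbBob t y m := by
  simp only [viewAl, massAt, Fintype.sum_prod_type, Prod.mk.injEq, transcript_eq_iff, coinProb]
  rw [Finset.sum_eq_single r (by simp +contextual) (by simp), compatProbBob, compatProb,
    Finset.mul_sum]
  refine Finset.sum_congr rfl fun s _ => ?_
  rw [ite_zero_mul_ite_zero]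
  simp only [true_and, CompatBob]

lemma transcriptProb_eq_mul (t : ℕ) (x : X) (y : Y) (m : List (List Bool)) :
    P.transcriptProb t x y m = P.compatProbAl t x m * P.compatProbBob t y m := by
  have h := sum_massAt_prodMk_left (pr := P.coinProb) (fun c => c.1)
    (fun c => P.transcript x y c.1 c.2 t) m
  rw [transcriptProb, ← h, compatProbAl, compatProb, Finset.sum_mul]
  exact Finset.sum_congr rfl fun r _ => viewAl_apply t x y r m

variable {f : X → Y → Z}

lemma isMonochromatic_transcriptProb
    (h : ∀ t ≤ P.rounds, IsPrivate f (P.viewAl t) (P.viewBob t)) {R C : Type*} {i : R → X}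
    {j : C → Y} (hrow : ∀ x x', Relation.TransGen (RowRel ((Matrix.of f).submatrix i j)) x x')
    (hcol : ∀ y y', Relation.TransGen (ColRel ((Matrix.of f).submatrix i j)) y y') {t : ℕ}
    (ht : t ≤ P.rounds) :
    IsMonochromatic (Matrix.of fun x y => P.transcriptProb t (i x) (j y)) := by
  induction t with
  | zero => exact fun _ _ _ _ => rfl
  | succ t ih =>
    replace ih x x' y y' m := congrFun (ih (by omega) x x' y y') m
    simp only [Matrix.of_apply, transcriptProb_eq_mul] at ih
    cases hs : P.speaker t with
    | al =>
      refine isMonochromatic_of_row_const (fun x x' => Relation.TransGen.mono ?_ _ _ (hrow x x'))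
        fun x y y' => funext fun m => ?_
      · rintro x x' ⟨y, hy⟩
        exact ⟨y, massAt_comp_congr ((h _ ht).bob _ _ _ hy) Prod.snd⟩
      · simp only [Matrix.of_apply, transcriptProb_eq_mul]
        exact compatProb_mul_succ P.distAl.2.1 (by simp [hs]) (fun m => ih x x y y' m) m
    | bob =>
      refine isMonochromatic_of_col_const (fun y y' => Relation.TransGen.mono ?_ _ _ (hcol y y'))
        fun x x' y => funext fun m => ?_
      · rintro y y' ⟨x, hx⟩
        exact ⟨x, massAt_comp_congr ((h _ ht).al _ _ _ hx) Prod.snd⟩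
      · simp only [Matrix.of_apply, transcriptProb_eq_mul, mul_comm (P.compatProbAl _ _ _)] at ih ⊢
        exact compatProb_mul_succ P.distBob.2.1 (by simp [hs]) (fun m => ih x x' y y m) m

lemma viewAl_eq_of_transcriptProb_eq {t : ℕ} {x : X} {y y' : Y}
    (h : P.transcriptProb t x y = P.transcriptProb t x y') : P.viewAl t x y = P.viewAl t x y' := by
  classical
  funext ⟨r, m⟩
  have hm := congrFun h m
  rw [transcriptProb_eq_mul, transcriptProb_eq_mul] at hm
  rw [viewAl_apply, viewAl_apply]
  exact mul_eq_mul_of_le (ite_nonneg (P.distAl.2.1 r) le_rfl)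
    (ite_le_compatProb (speaks := fun t => P.speaker t = Player.al)
      (msg := fun r t => P.msgAl t x r) P.distAl.2.1 r m) hm

lemma resultProb_eq_massAt (p : Player) (x : X) (y : Y) (z : Z) :
    P.resultProb p x y z = massAt P.coinProb (fun c => P.result p x y c.1 c.2) z := by
  simp only [resultProb, massAt, coinProb, Fintype.sum_prod_type]

lemma resultProb_al_eq_of_viewAl_eq {x : X} {y y' : Y}
    (h : P.viewAl P.rounds x y = P.viewAl P.rounds x y') (z : Z) :
    P.resultProb Player.al x y z = P.resultProb Player.al x y' z := by
  rw [resultProb_eq_massAt, resultProb_eq_massAt]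
  exact congrFun (massAt_comp_congr h fun v => P.outAl x v.1 v.2) z

lemma resultProb_add_le (p : Player) (x : X) (y : Y) {z z' : Z} (hz : z ≠ z') :
    P.resultProb p x y z + P.resultProb p x y z' ≤ 1 := by
  rw [← P.coinProb_mem_stdSimplex.2, resultProb_eq_massAt, resultProb_eq_massAt, massAt, massAt,
    ← Finset.sum_add_distrib]
  refine Finset.sum_le_sum fun c _ => ?_
  have hc := P.coinProb_mem_stdSimplex.1 c
  split_ifs with h h'
  · exact absurd (h.symm.trans h') hz
  all_goals simp [hc]

lemma Computes.eq_of_resultProb_eq {p : Player} {ε : ℝ} (h : P.Computes p f ε) (hε : ε < 1 / 2)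
    {x x' : X} {y y' : Y} (heq : ∀ z, P.resultProb p x y z = P.resultProb p x' y' z) :
    f x y = f x' y' := by
  by_contra hne
  have hxy := h x y
  rw [heq] at hxy
  linarith [h x' y', resultProb_add_le (P := P) p x' y' hne]

theorem not_computes_of_containsForbidden [Fintype X] [Fintype Y] (hf : ContainsForbidden f)
    (hloss : P.privacyLoss f = 0) {ε : ℝ} (hε : ε < 1 / 2) : ¬ P.Computes Player.al f ε := by
  intro hP
  obtain ⟨A, B, hM⟩ := hf
  obtain ⟨⟨x₀⟩, ⟨y₀⟩⟩ := hM.nonempty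
  have : Nonempty X := ⟨x₀⟩
  have : Nonempty Y := ⟨y₀⟩
  obtain ⟨hrow, hcol, hmono⟩ := hM
  have htranscript := isMonochromatic_transcriptProb (privacyLoss_eq_zero_iff.1 hloss) hrow hcol
    le_rfl
  exact hmono (isMonochromatic_of_row_const hrow fun x y y' => hP.eq_of_resultProb_eq hε
    (resultProb_al_eq_of_viewAl_eq (viewAl_eq_of_transcriptProb_eq (htranscript x x y y'))))

end ClassicalProtocol

end ClassicalLowerBound

/-! # Functions without forbidden submatrices -/

section Blocks

variable {X Y Z : Type*}

/-- The player whose turn it is in round `t`, when Al begins and the players alternate. -/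
def turn (t : ℕ) : Player :=
  if Even t then Player.al else Player.bob

/-- The rows that are equivalent to `x` in the submatrix of `f` with rows `A` and columns `B`. -/
def rowClass (f : X → Y → Z) (A : Set X) (B : Set Y) (x : X) : Set X :=
  {x' | ∃ (hx : x ∈ A) (hx' : x' ∈ A), Relation.TransGen (RowRel ((Matrix.of f).submatrix
    (fun a : A => (a : X)) fun b : B => (b : Y))) ⟨x, hx⟩ ⟨x', hx'⟩}

/-- The submatrix that contains the entry `(x, y)` after `t` rounds, when the players take turns at
announcing the equivalence class of their inputs inside the present submatrix. -/
noncomputable def block (f : X → Y → Z) : ℕ → X → Y → Set X × Set Y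
  | 0, _, _ => (Set.univ, Set.univ)
  | t + 1, x, y =>
    let b := block f t x y
    match turn t with
    | Player.al => (rowClass f b.1 b.2 x, b.2)
    | Player.bob => (b.1, rowClass (fun y x => f x y) b.2 b.1 y)

/-- Labels `L t x y` such that, when the players in turn announce the label `L (t + 1) x y`, nothing
but the value of `f` is revealed and that value is determined after `N` rounds. -/
structure IsPrivateLabeling {Λ : Type*} (f : X → Y → Z) (N : ℕ) (L : ℕ → X → Y → Λ) : Prop where
  zero : ∀ x x' y y', L 0 x y = L 0 x' y'
  al : ∀ t, turn t = Player.al → ∀ x y y', L t x y = L t x y' ↔ L (t + 1) x y = L (t + 1) x y'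
  bob : ∀ t, turn t = Player.bob → ∀ x x' y, L t x y = L t x' y ↔ L (t + 1) x y = L (t + 1) x' y
  isPrivate : ∀ t, IsPrivate f (L t) (L t)
  val : ∀ x x' y y', L N x y = L N x' y' → f x y = f x' y'

lemma turn_succ_ne (t : ℕ) : turn (t + 1) ≠ turn t := by
  by_cases ht : Even t <;> simp [turn, Nat.even_add_one, ht]

section RowClass

variable {f : X → Y → Z} {A : Set X} {B : Set Y} {x x' : X} {y : Y}

lemma rowClass_subset : rowClass f A B x ⊆ A :=
  fun _ ⟨_, hx', _⟩ => hx'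

lemma mem_rowClass_of_eq (hx : x ∈ A) (hx' : x' ∈ A) (hy : y ∈ B) (h : f x y = f x' y) :
    x' ∈ rowClass f A B x :=
  ⟨hx, hx', .single ⟨⟨y, hy⟩, h⟩⟩

lemma mem_rowClass_symm (h : x' ∈ rowClass f A B x) : x ∈ rowClass f A B x' := by
  obtain ⟨hx, hx', h⟩ := h
  have : Std.Symm (RowRel ((Matrix.of f).submatrix (fun a : A => (a : X)) fun b : B => (b : Y))) :=
    ⟨fun _ _ ⟨y, hy⟩ => ⟨y, hy.symm⟩⟩
  exact ⟨hx', hx, Relation.TransGen.stdSymm.symm _ _ h⟩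

lemma mem_rowClass_trans {x'' : X} (h : x' ∈ rowClass f A B x) (h' : x'' ∈ rowClass f A B x') :
    x'' ∈ rowClass f A B x := by
  obtain ⟨hx, _, h⟩ := h
  obtain ⟨_, hx'', h'⟩ := h'
  exact ⟨hx, hx'', h.trans h'⟩

lemma rowClass_eq_of_mem (h : x' ∈ rowClass f A B x) : rowClass f A B x' = rowClass f A B x :=
  Set.ext fun _ => ⟨mem_rowClass_trans h, mem_rowClass_trans (mem_rowClass_symm h)⟩

lemma transGen_rowRel_of_rowClass_eq (h : rowClass f A B x = A) (a a' : A) :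
    Relation.TransGen (RowRel ((Matrix.of f).submatrix
      (fun a : A => (a : X)) fun b : B => (b : Y))) a a' := by
  have hmem (a : A) : (a : X) ∈ rowClass f A B x := h.ge a.2
  exact (mem_rowClass_trans (mem_rowClass_symm (hmem a)) (hmem a')).2.2

end RowClass

variable {f : X → Y → Z} {t : ℕ} {x x' : X} {y y' : Y}

lemma block_succ_of_al (ht : turn t = Player.al) (x : X) (y : Y) : block f (t + 1) x y
    = (rowClass f (block f t x y).1 (block f t x y).2 x, (block f t x y).2) := by
  rw [block, ht]

lemma block_succ_of_bob (ht : turn t = Player.bob) (x : X) (y : Y) : block f (t + 1) x y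
    = ((block f t x y).1, rowClass (fun y x => f x y) (block f t x y).2 (block f t x y).1 y) := by
  rw [block, ht]

variable (f) in
lemma mem_block (t : ℕ) (x : X) (y : Y) : x ∈ (block f t x y).1 ∧ y ∈ (block f t x y).2 := by
  induction t with
  | zero => exact ⟨trivial, trivial⟩
  | succ t ih =>
    cases ht : turn t with
    | al =>
      rw [block_succ_of_al ht]
      exact ⟨mem_rowClass_of_eq ih.1 ih.1 ih.2 rfl, ih.2⟩
    | bob =>
      rw [block_succ_of_bob ht]
      exact ⟨ih.1, mem_rowClass_of_eq ih.2 ih.2 ih.1 rfl⟩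

variable (f) in
lemma block_succ_le (t : ℕ) (x : X) (y : Y) : block f (t + 1) x y ≤ block f t x y := by
  cases ht : turn t with
  | al =>
    rw [block_succ_of_al ht]
    exact ⟨rowClass_subset, le_rfl⟩
  | bob =>
    rw [block_succ_of_bob ht]
    exact ⟨le_rfl, rowClass_subset⟩

lemma block_eq_of_mem (hx : x' ∈ (block f t x y).1) (hy : y' ∈ (block f t x y).2) :
    block f t x' y' = block f t x y := by
  induction t with
  | zero => rfl
  | succ t ih =>
    replace ih := ih ((block_succ_le f t x y).1 hx) ((block_succ_le f t x y).2 hy)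
    cases ht : turn t with
    | al =>
      rw [block_succ_of_al ht] at hx hy ⊢
      rw [block_succ_of_al ht, ih, rowClass_eq_of_mem hx]
    | bob =>
      rw [block_succ_of_bob ht] at hx hy ⊢
      rw [block_succ_of_bob ht, ih, rowClass_eq_of_mem hy]

lemma block_eq_of_block_succ_eq (h : block f (t + 1) x y = block f (t + 1) x' y') :
    block f t x y = block f t x' y' := by
  obtain ⟨hx, hy⟩ := mem_block f (t + 1) x y
  rw [h] at hx hy
  exact block_eq_of_mem ((block_succ_le f t x' y').1 hx) ((block_succ_le f t x' y').2 hy)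

lemma isPrivate_block (f : X → Y → Z) (t : ℕ) : IsPrivate f (block f t) (block f t) := by
  induction t with
  | zero => exact ⟨fun _ _ _ _ => rfl, fun _ _ _ _ => rfl⟩
  | succ t ih =>
    refine ⟨fun x y y' h => ?_, fun x x' y h => ?_⟩
    all_goals cases ht : turn t
    · rw [block_succ_of_al ht, block_succ_of_al ht, ih.al x y y' h]
    · have hy := (mem_block f t x y).2
      rw [ih.al x y y' h] at hy
      rw [block_succ_of_bob ht, block_succ_of_bob ht, ih.al x y y' h,
        rowClass_eq_of_mem (f := fun y x => f x y)
          (mem_rowClass_of_eq (mem_block f t x y').2 hy (mem_block f t x y').1 h.symm)]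
    · have hx := (mem_block f t x y).1
      rw [ih.bob x x' y h] at hx
      rw [block_succ_of_al ht, block_succ_of_al ht, ih.bob x x' y h, rowClass_eq_of_mem
        (mem_rowClass_of_eq (mem_block f t x' y).1 hx (mem_block f t x' y).2 h.symm)]
    · rw [block_succ_of_bob ht, block_succ_of_bob ht, ih.bob x x' y h]

lemma rowClass_eq_of_block_add_two_eq (h : block f (t + 2) x y = block f t x y) :
    rowClass f (block f t x y).1 (block f t x y).2 x = (block f t x y).1 ∧
      rowClass (fun y x => f x y) (block f t x y).2 (block f t x y).1 y = (block f t x y).2 := by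
  have h' : block f (t + 1) x y = block f t x y :=
    le_antisymm (block_succ_le f t x y) (h ▸ block_succ_le f (t + 1) x y)
  cases ht : turn t with
  | al =>
    have ht' : turn (t + 1) = Player.bob := (player_ne_iff_eq (by simp)).1 (ht ▸ turn_succ_ne t)
    rw [block_succ_of_bob ht', h'] at h
    rw [block_succ_of_al ht] at h'
    exact ⟨congrArg Prod.fst h', congrArg Prod.snd h⟩
  | bob =>
    have ht' : turn (t + 1) = Player.al := (player_ne_iff_eq (by simp)).1 (ht ▸ turn_succ_ne t)
    rw [block_succ_of_al ht', h'] at h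
    rw [block_succ_of_bob ht] at h'
    exact ⟨congrArg Prod.fst h, congrArg Prod.snd h'⟩

lemma isMonochromatic_of_rowClass_eq (hf : ¬ ContainsForbidden f) {A : Set X} {B : Set Y}
    (hA : rowClass f A B x = A) (hB : rowClass (fun y x => f x y) B A y = B) :
    IsMonochromatic ((Matrix.of f).submatrix (fun a : A => (a : X)) fun b : B => (b : Y)) := by
  by_contra hmono
  exact hf ⟨A, B, transGen_rowRel_of_rowClass_eq hA, transGen_rowRel_of_rowClass_eq hB, hmono⟩

lemma exists_forall_block_add_eq [Finite X] [Finite Y] (f : X → Y → Z) :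
    ∃ N, ∀ x y k, block f (N + k) x y = block f N x y := by
  have hstable (p : X × Y) : ∃ n, ∀ m, n ≤ m → block f n p.1 p.2 = block f m p.1 p.2 :=
    WellFoundedGT.monotone_chain_condition
      (⟨fun t => OrderDual.toDual (block f t p.1 p.2),
        monotone_nat_of_le_succ fun t => block_succ_le f t p.1 p.2⟩ : ℕ →o (Set X × Set Y)ᵒᵈ)
  choose n hn using hstable
  obtain ⟨N, hN⟩ := (Set.finite_range n).bddAbove
  refine ⟨N, fun x y k => ?_⟩
  have hNxy : n (x, y) ≤ N := hN ⟨(x, y), rfl⟩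
  exact (hn (x, y) _ (hNxy.trans (Nat.le_add_right N k))).symm.trans (hn (x, y) _ hNxy)

theorem exists_isPrivateLabeling_block [Finite X] [Finite Y] (hf : ¬ ContainsForbidden f) :
    ∃ N, IsPrivateLabeling f N (block f) := by
  obtain ⟨N, hN⟩ := exists_forall_block_add_eq f
  refine ⟨N, fun _ _ _ _ => rfl, fun t ht x y y' => ⟨fun h => ?_, block_eq_of_block_succ_eq⟩,
    fun t ht x x' y => ⟨fun h => ?_, block_eq_of_block_succ_eq⟩, isPrivate_block f,
    fun x x' y y' h => ?_⟩
  · rw [block_succ_of_al ht, block_succ_of_al ht, h]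
  · rw [block_succ_of_bob ht, block_succ_of_bob ht, h]
  · obtain ⟨hA, hB⟩ := rowClass_eq_of_block_add_two_eq (hN x' y' 2)
    obtain ⟨hx, hy⟩ := mem_block f N x y
    obtain ⟨hx', hy'⟩ := mem_block f N x' y'
    rw [h] at hx hy
    exact isMonochromatic_of_rowClass_eq hf hA hB ⟨x, hx⟩ ⟨x', hx'⟩ ⟨y, hy⟩ ⟨y', hy'⟩

end Blocks

/-! # Classical announcements -/

section Protocols

variable {X Y Z Λ : Type*} {f : X → Y → Z} {N : ℕ}

lemma IsPrivateLabeling.comp_injective {Λ' : Type*} {L : ℕ → X → Y → Λ}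
    (h : IsPrivateLabeling f N L) {e : Λ → Λ'} (he : e.Injective) :
    IsPrivateLabeling f N fun t x y => e (L t x y) where
  zero x x' y y' := congrArg e (h.zero x x' y y')
  al t ht x y y' := by simpa only [he.eq_iff] using h.al t ht x y y'
  bob t ht x x' y := by simpa only [he.eq_iff] using h.bob t ht x x' y
  isPrivate t := ⟨fun x y y' hf => congrArg e ((h.isPrivate t).al x y y' hf),
    fun x x' y hf => congrArg e ((h.isPrivate t).bob x x' y hf)⟩
  val x x' y y' hL := h.val x x' y y' (he hL)

section Classical

/-- The labels announced in the first `t` rounds. -/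
def announcements (L : ℕ → X → Y → Λ) (t : ℕ) (x : X) (y : Y) : List Λ :=
  (List.range t).map fun s => L (s + 1) x y

lemma announcements_succ (L : ℕ → X → Y → Λ) (t : ℕ) (x : X) (y : Y) :
    announcements L (t + 1) x y = announcements L t x y ++ [L (t + 1) x y] := by
  simp [announcements, List.range_succ]

lemma IsPrivateLabeling.isPrivate_announcements {L : ℕ → X → Y → Λ} (h : IsPrivateLabeling f N L)
    (t : ℕ) : IsPrivate f (announcements L t) (announcements L t) where
  al x y y' hf := by simp only [announcements, (h.isPrivate _).al x y y' hf]
  bob x x' y hf := by simp only [announcements, (h.isPrivate _).bob x x' y hf]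

lemma IsPrivateLabeling.eq_of_announcements_eq {L : ℕ → X → Y → Λ} (h : IsPrivateLabeling f N L)
    {t : ℕ} {x x' : X} {y y' : Y} (heq : announcements L t x y = announcements L t x' y') :
    L t x y = L t x' y' := by
  cases t with
  | zero => exact h.zero x x' y y'
  | succ t =>
    rw [announcements_succ, announcements_succ, List.append_singleton_inj] at heq
    exact heq.2

namespace ClassicalProtocol

variable [Nonempty X] [Nonempty Y]

/-- The deterministic protocol in which the players take turns at announcing the labels
`L (t + 1) x y`; each of them infers what he needs from his input and the labels announced so
far. -/
noncomputable def announcing (f : X → Y → Z) (N : ℕ) (L : ℕ → X → Y → List Bool) :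
    ClassicalProtocol X Y Z where
  coinsAl := 1
  coinsBob := 1
  distAl := ⟨_, single_mem_stdSimplex ℝ 0⟩
  distBob := ⟨_, single_mem_stdSimplex ℝ 0⟩
  rounds := N
  speaker := turn
  msgAl t x _ := Function.extend (announcements L t x) (L (t + 1) x) fun _ => []
  msgBob t y _ :=
    Function.extend (fun x => announcements L t x y) (fun x => L (t + 1) x y) fun _ => []
  outAl x _ :=
    Function.extend (announcements L N x) (f x) fun _ => f x (Classical.arbitrary Y)
  outBob y _ :=
    Function.extend (fun x => announcements L N x y) (fun x => f x y)
      fun _ => f (Classical.arbitrary X) y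

variable {L : ℕ → X → Y → List Bool}

lemma transcript_announcing (h : IsPrivateLabeling f N L) (x : X) (y : Y)
    (r : Fin (announcing f N L).coinsAl) (s : Fin (announcing f N L).coinsBob) (t : ℕ) :
    (announcing f N L).transcript x y r s t = announcements L t x y := by
  induction t with
  | zero => rfl
  | succ t ih =>
    rw [transcript, ih, announcements_succ]
    cases ht : turn t with
    | al =>
      have hmsg : (L (t + 1) x).FactorsThrough (announcements L t x) := fun y y' heq =>
        (h.al t ht x y y').1 (h.eq_of_announcements_eq heq)
      simp only [ht, announcing, hmsg.extend_apply]
    | bob =>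
      have hmsg : (fun x => L (t + 1) x y).FactorsThrough fun x => announcements L t x y :=
        fun x x' heq => (h.bob t ht x x' y).1 (h.eq_of_announcements_eq heq)
      simp only [ht, announcing, hmsg.extend_apply _ x]

lemma result_announcing (h : IsPrivateLabeling f N L) (p : Player) (x : X) (y : Y)
    (r : Fin (announcing f N L).coinsAl) (s : Fin (announcing f N L).coinsBob) :
    (announcing f N L).result p x y r s = f x y := by
  cases p with
  | al =>
    have hout : (f x).FactorsThrough (announcements L N x) := fun y y' heq =>
      h.val x x y y' (h.eq_of_announcements_eq heq)
    rw [result, transcript_announcing h]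
    exact hout.extend_apply (fun _ => f x (Classical.arbitrary Y)) y
  | bob =>
    have hout : (fun x => f x y).FactorsThrough fun x => announcements L N x y := fun x x' heq =>
      h.val x x' y y (h.eq_of_announcements_eq heq)
    rw [result, transcript_announcing h]
    exact hout.extend_apply (fun _ => f (Classical.arbitrary X) y) x

lemma computes_announcing (h : IsPrivateLabeling f N L) (p : Player) :
    (announcing f N L).Computes p f 0 := by
  intro x y
  rw [sub_zero, resultProb_eq_massAt, massAt,
    ← (announcing f N L).coinProb_mem_stdSimplex.2]
  exact (Finset.sum_congr rfl fun c _ => (if_pos (result_announcing h p x y _ _)).symm).le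

lemma privacyLoss_announcing [Fintype X] [Fintype Y] (h : IsPrivateLabeling f N L) :
    (announcing f N L).privacyLoss f = 0 := by
  refine privacyLoss_eq_zero_iff.2 fun t _ => ⟨fun x y y' hf => ?_, fun x x' y hf => ?_⟩
  · unfold viewAl
    simp only [transcript_announcing h, (h.isPrivate_announcements t).al x y y' hf]
  · unfold viewBob
    simp only [transcript_announcing h, (h.isPrivate_announcements t).bob x x' y hf]

end ClassicalProtocol

theorem IsPrivateLabeling.deterministicPrivate [Fintype X] [Fintype Y] [Nonempty X] [Nonempty Y]
    [Countable Λ] {L : ℕ → X → Y → Λ} (h : IsPrivateLabeling f N L) : DeterministicPrivate f := by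
  obtain ⟨e, he⟩ := exists_injective_nat Λ
  have h' := h.comp_injective ((List.replicate_left_injective true).comp he)
  exact ⟨_, ⟨rfl, rfl⟩, ClassicalProtocol.computes_announcing h',
    ClassicalProtocol.privacyLoss_announcing h'⟩

end Classical

end Protocols

/-! # Quantum announcements -/

section QuantumAnnouncement

open Matrix

lemma exists_perm_apply_eq {ι β : Type*} [Finite β] {u v : ι → β}
    (h : ∀ i j, u i = u j ↔ v i = v j) : ∃ σ : Equiv.Perm β, ∀ i, σ (u i) = v i := by
  classical
  have := Fintype.ofFinite β
  let e : {b // b ∈ Set.range u} ≃ {b // b ∈ Set.range v} :=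
    (Setoid.quotientKerEquivRange u).symm.trans
      ((Quotient.congrRight h).trans (Setoid.quotientKerEquivRange v))
  have he i : e ⟨u i, i, rfl⟩ = ⟨v i, i, rfl⟩ := by
    have hsymm : (Setoid.quotientKerEquivRange u).symm ⟨u i, i, rfl⟩ = Quotient.mk _ i := by
      rw [Equiv.symm_apply_eq]
      rfl
    simp only [e, Equiv.trans_apply, hsymm]
    rfl
  refine ⟨e.extendSubtype, fun i => ?_⟩
  rw [e.extendSubtype_apply_of_mem _ ⟨i, rfl⟩, he]

lemma permMatrix_mem_unitaryGroup {n α : Type*} [Fintype n] [DecidableEq n] [CommRing α]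
    [StarRing α] (σ : Equiv.Perm n) : σ.permMatrix α ∈ unitaryGroup n α := by
  rw [mem_unitaryGroup_iff, star_eq_conjTranspose, conjTranspose_permMatrix, ← permMatrix_mul,
    inv_mul_cancel, permMatrix_one]

lemma exists_encoding {Λ : Type*} [Finite Λ] (l₀ : Λ) :
    ∃ (n : ℕ) (enc : Λ → Fin n → Bool) (half : Fin n → Player), (enc l₀ = fun _ => false) ∧
      ∀ p l l', (∀ q, half q = p → enc l q = enc l' q) → l = l' := by
  classical
  have : Finite Player := .of_surjective (fun b => cond b Player.al Player.bob) fun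
    | .al => ⟨true, rfl⟩
    | .bob => ⟨false, rfl⟩
  obtain ⟨n, ⟨e⟩⟩ := Finite.exists_equiv_fin (Λ × Player)
  refine ⟨n, fun l q => decide (l = (e.symm q).1 ∧ l ≠ l₀), fun q => (e.symm q).2,
    by simp, fun p l l' h => ?_⟩
  have hl := h (e (l, p)) (by simp)
  have hl' := h (e (l', p)) (by simp)
  simp only [Equiv.symm_apply_apply, decide_eq_decide] at hl hl'
  grind

section BasisUnitary

variable {ι : Type*} {n : ℕ} {S : Fin n → Prop} [DecidablePred S] {u v : ι → Fin n → Bool}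

lemma applyLocal_comp_restrict (U : Matrix (Bits S) (Bits S) ℂ) (φ : Bits S → ℂ) :
    applyLocal S U (fun c => φ fun q => c q) = fun c => (U *ᵥ φ) fun q => c q := by
  funext c
  simp only [applyLocal, restrict_merge, mulVec, dotProduct]

lemma exists_unitary_applyLocal_single (hS : ∀ q, S q) (h : ∀ i j, u i = u j ↔ v i = v j) :
    ∃ U : unitaryGroup (Bits S) ℂ, ∀ i,
      applyLocal S U.1 (Pi.single (u i) 1) = Pi.single (v i) 1 := by
  have hrestrict {c d : Fin n → Bool} :
      ((fun q : {q // S q} => c q) = fun q : {q // S q} => d q) ↔ c = d :=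
    ⟨fun hcd => funext fun q => congrFun hcd ⟨q, hS q⟩, fun hcd => hcd ▸ rfl⟩
  have hsingle (d : Fin n → Bool) : (Pi.single d 1 : (Fin n → Bool) → ℂ) =
      fun c => Pi.single (M := fun _ => ℂ) (fun q : {q // S q} => d q) 1 fun q => c q := by
    funext c
    simp only [Pi.single_apply, hrestrict]
  obtain ⟨σ, hσ⟩ := exists_perm_apply_eq (u := fun i (q : {q // S q}) => v i q)
    (v := fun i (q : {q // S q}) => u i q) fun i j => by rw [hrestrict, hrestrict, h]
  refine ⟨⟨σ.permMatrix ℂ, permMatrix_mem_unitaryGroup σ⟩, fun i => ?_⟩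
  rw [hsingle, hsingle, applyLocal_comp_restrict, permMatrix_mulVec, ← hσ]
  funext c
  simp only [Function.comp_apply, Pi.single_apply, σ.apply_eq_iff_eq]

open Classical in
/-- A unitary transformation of the qubits in `S` that takes the basis state `u i` of all qubits to
the basis state `v i` for every `i`, and the identity if there is none. -/
noncomputable def basisUnitary (S : Fin n → Prop) [DecidablePred S] (u v : ι → Fin n → Bool) :
    unitaryGroup (Bits S) ℂ :=
  if h : ∃ U : unitaryGroup (Bits S) ℂ, ∀ i,
      applyLocal S U.1 (Pi.single (u i) 1) = Pi.single (v i) 1 then h.choose else 1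

lemma applyLocal_basisUnitary_single (hS : ∀ q, S q) (h : ∀ i j, u i = u j ↔ v i = v j) (i : ι) :
    applyLocal S (basisUnitary S u v).1 (Pi.single (u i) 1) = Pi.single (v i) 1 := by
  have hex := exists_unitary_applyLocal_single hS h
  rw [basisUnitary, dif_pos hex]
  exact hex.choose_spec i

end BasisUnitary

variable {X Y Z Λ : Type*} {f : X → Y → Z} {N : ℕ}

namespace QuantumProtocol

lemma resultProb_eq_one_of_state_eq_single {P : QuantumProtocol X Y Z} {x : X} {y : Y}
    {d : Fin P.qubits → Bool} (p : Player) (h : P.state x y P.rounds = Pi.single d 1) :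
    P.resultProb p x y (P.result p x y d) = 1 := by
  rw [resultProb, h, Fintype.sum_eq_single d fun c hc => by simp [hc], if_pos rfl]
  simp

variable [Nonempty X] [Nonempty Y] {n : ℕ}

/-- The protocol in which all qubits travel back and forth, in the basis state `L t x y` after `t`
rounds, until player `p` receives the qubits `q` with `half q = p` in round `N`. -/
noncomputable def announcing (f : X → Y → Z) (N : ℕ) (half : Fin n → Player)
    (L : ℕ → X → Y → Fin n → Bool) : QuantumProtocol X Y Z where
  qubits := n
  rounds := N
  speaker := turn
  owner t q := if t < N then turn t else half q
  owner_succ t q hq := by grind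
  opAl t x := basisUnitary _ (L t x) (L (t + 1) x)
  opBob t y := basisUnitary _ (fun x => L t x y) fun x => L (t + 1) x y
  outAl x := Function.extend (fun y (q : Subtype _) => L N x y q) (f x)
    fun _ => f x (Classical.arbitrary Y)
  outBob y := Function.extend (fun x (q : Subtype _) => L N x y q) (fun x => f x y)
    fun _ => f (Classical.arbitrary X) y

variable {half : Fin n → Player} {L : ℕ → X → Y → Fin n → Bool}

lemma state_announcing (h : IsPrivateLabeling f N L) (h₀ : ∀ x y, L 0 x y = fun _ => false)
    (x : X) (y : Y) {t : ℕ} (ht : t ≤ N) :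
    (announcing f N half L).state x y t = Pi.single (L t x y) 1 := by
  induction t with
  | zero => rw [h₀]; rfl
  | succ t ih =>
    have howner {p : Player} (hp : turn t = p) (q) : (announcing f N half L).owner t q = p :=
      (if_pos ht).trans hp
    have hspeaker : (announcing f N half L).speaker t = turn t := rfl
    rw [state, ih (Nat.le_of_succ_le ht), hspeaker]
    cases hp : turn t with
    | al => exact applyLocal_basisUnitary_single (howner hp) (h.al t hp x) y
    | bob =>
      exact applyLocal_basisUnitary_single (howner hp) (fun x x' => h.bob t hp x x' y) x

lemma result_announcing (h : IsPrivateLabeling f N L)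
    (hhalf : ∀ p x x' y y', (∀ q, half q = p → L N x y q = L N x' y' q) → L N x y = L N x' y')
    (p : Player) (x : X) (y : Y) : (announcing f N half L).result p x y (L N x y) = f x y := by
  let ownerN : Fin n → Player := (announcing f N half L).owner N
  have howner (q) : ownerN q = half q := if_neg (lt_irrefl N)
  cases p with
  | al =>
    have hout : (f x).FactorsThrough fun y (q : {q // ownerN q = Player.al}) => L N x y q :=
      fun y y' heq => h.val x x y y' (hhalf Player.al x x y y' fun q hq =>
        congrFun heq ⟨q, (howner q).trans hq⟩)
    exact hout.extend_apply (fun _ => f x (Classical.arbitrary Y)) y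
  | bob =>
    have hout : (fun x => f x y).FactorsThrough
        fun x (q : {q // ownerN q = Player.bob}) => L N x y q :=
      fun x x' heq => h.val x x' y y (hhalf Player.bob x x' y y fun q hq =>
        congrFun heq ⟨q, (howner q).trans hq⟩)
    exact hout.extend_apply (fun _ => f (Classical.arbitrary X) y) x

lemma computes_announcing (h : IsPrivateLabeling f N L) (h₀ : ∀ x y, L 0 x y = fun _ => false)
    (hhalf : ∀ p x x' y y', (∀ q, half q = p → L N x y q = L N x' y' q) → L N x y = L N x' y')
    (p : Player) : (announcing f N half L).Computes p f 0 := by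
  intro x y
  rw [sub_zero, ← resultProb_eq_one_of_state_eq_single p (state_announcing h h₀ x y le_rfl)]
  exact (congrArg _ (result_announcing h hhalf p x y)).le

lemma privacyLoss_announcing [Fintype X] [Fintype Y] (h : IsPrivateLabeling f N L)
    (h₀ : ∀ x y, L 0 x y = fun _ => false) : (announcing f N half L).privacyLoss f = 0 := by
  refine privacyLoss_eq_zero_iff.2 fun t ht => ⟨fun x y y' hf => ?_, fun x x' y hf => ?_⟩
  · rw [localState, localState, state_announcing h h₀ x y ht, state_announcing h h₀ x y' ht,
      (h.isPrivate t).al x y y' hf]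
  · rw [localState, localState, state_announcing h h₀ x y ht, state_announcing h h₀ x' y ht,
      (h.isPrivate t).bob x x' y hf]

end QuantumProtocol

theorem IsPrivateLabeling.quantumPrivate [Fintype X] [Fintype Y] [Nonempty X] [Nonempty Y]
    [Finite Λ] {L : ℕ → X → Y → Λ} (h : IsPrivateLabeling f N L) : QuantumPrivate f 0 := by
  obtain ⟨n, enc, half, henc₀, hhalf⟩ :=
    exists_encoding (L 0 (Classical.arbitrary X) (Classical.arbitrary Y))
  have henc : enc.Injective := fun l l' hl => hhalf Player.al l l' fun q _ => congrFun hl q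
  have h₀ x y : enc (L 0 x y) = fun _ => false := by rw [h.zero x _ y, henc₀]
  have h' := h.comp_injective henc
  exact ⟨_, QuantumProtocol.computes_announcing (half := half) h' h₀
      fun p x x' y y' hq => congrArg enc (hhalf p _ _ hq),
    QuantumProtocol.privacyLoss_announcing h' h₀⟩

end QuantumAnnouncement

theorem mainTheorem4 {X Y Z : Type*} [Fintype X] [Fintype Y] [Nonempty X] [Nonempty Y]
    (f : X → Y → Z) :
    (ContainsForbidden f →
      ∀ (ε : ℝ), ε < 1 / 2 → ∀ (P : QuantumProtocol X Y Z) (p : Player),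
        P.Computes p f ε → P.privacyLoss f ≠ 0) ∧
    List.TFAE [
      ¬ ContainsForbidden f,
      DeterministicPrivate f,
      ClassicalPrivate f 0,
      ∃ ε : ℝ, ε < 1 / 2 ∧ ClassicalPrivate f ε,
      QuantumPrivate f 0,
      ∃ ε : ℝ, ε < 1 / 2 ∧ QuantumPrivate f ε] := by
  refine ⟨fun hf ε hε P p hP hloss =>
    QuantumProtocol.not_computes_of_containsForbidden hf hloss hε hP, ?_⟩
  tfae_have 1 → 2 := fun hf =>
    (exists_isPrivateLabeling_block hf).elim fun _ h => h.deterministicPrivate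
  tfae_have 2 → 3 := fun ⟨P, _, hP, hloss⟩ => ⟨P, hP, hloss⟩
  tfae_have 3 → 4 := fun h => ⟨0, by norm_num, h⟩
  tfae_have 4 → 1 := fun ⟨_, hε, _, hP, hloss⟩ hf =>
    ClassicalProtocol.not_computes_of_containsForbidden hf hloss hε (hP Player.al)
  tfae_have 1 → 5 := fun hf =>
    (exists_isPrivateLabeling_block hf).elim fun _ h => h.quantumPrivate
  tfae_have 5 → 6 := fun h => ⟨0, by norm_num, h⟩
  tfae_have 6 → 1 := fun ⟨_, hε, _, hP, hloss⟩ hf =>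
    QuantumProtocol.not_computes_of_containsForbidden hf hloss hε (hP Player.al)
  tfae_finish
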